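/- Let $A=\{a,b\}$ and let $A^*$ be the set of words over $A$ under subword order: $u\le w$ if $u$ is obtained from $w$ by deleting letters. For $d\ge 0$ let $A^*_d$ be the subposet of words without $d+1$ consecutive $b$'s, and let $[u,w]_d$ denote an interval of $A^*_d$. A set $\iota\subseteq\{1,\dots,|w|\}$ is an embedding of $u$ in $w=w_1\cdots w_n$ if the letters of $w$ at the positions in $\iota$, read from left to right, form $u$. Björner's labeling. Let $w=x_0\succ x_1\succ\dots\succ x_k=u$ be a maximal chain of an interval of $A^*$, and let $S_0=\{1,\dots,|w|\}$. For $j=1,\dots,k$ the edge $(x_{j-1},x_j)$ gets as label $i_j$, the least $i\in S_{j-1}$ such that $S_{j-1}\setminus\{i\}$ is an embedding of $x_j$ in $w$, and $S_j=S_{j-1}\setminus\{i_j\}$. A dual CL-labeling of a graded interval $[u,w]$ assigns integers to the edges of each maximal chain so that (i) if two maximal chains have the same first $s$ edges from the top, then these edges have the same labels in both; (ii) for all $u\le x\le y\le w$ and each maximal chain $r$ of $[y,w]$, exactly one maximal chain of $[x,y]$ has weakly increasing labels (read from top to bottom, in a maximal chain of $[u,w]$ that contains $r$), and its label sequence is lexicographically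 strictly smaller than that of every other maximal chain of $[x,y]$. **Theorem.** Let $d\ge 0$. 1. For all $u\le w$ in $A^*_d$, every maximal chain of $[u,w]_d$ is a maximal chain of the interval $[u,w]$ of $A^*$, and the restriction of Björner's labeling to the maximal chains of $[u,w]_d$ is a dual CL-labeling of $[u,w]_d$. 2. Hence $A^*_d$ is (dual) CL-shellable, that is, each of its intervals has a dual CL-labeling; and the order complex of each interval $[u,w]_d$ is pure and shellable. 3. For all $u,w\in A^*_d$ the number of maximal chains of $[u,w]_d$ whose labels, read from top to bottom, are strictly decreasing equals the number $\binom{w}{u}_{dn}$ of $d$-normal embeddings of $u$ in $w$, and the Möbius function of $A^*_d$ is $$\mu(u,w)=(-1)^{|w|+|u|}\binom{w}{u}_{dn}.$$ Here an embedding $\iota=\{i_1<\dots<i_k\}$ of $u$ in $w$ is $d$-normal if (a) $\iota$ contains every $j\ge 2$ with $w_j=w_{j-1}$; (b) whenever a run of $d$ $b$'s of $u$, with a first letter $u_j$, $j>1$, is not at the beginning of $u$, then $w_{i_j-1}=a$ and $i_j-1\in\iota$; (c) if $u$ begins with $d\geq 1$ $b$'s, then $i_1=1$, or $i_1=2$ and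 $w_1=a$. -/

import Mathlib

/-! ### Words over a two-letter alphabet under subword order -/

/-- The alphabet `A = {a, b}`. -/
inductive Letter : Type
  | a : Letter
  | b : Letter
  deriving DecidableEq

/-- The set `A*` of all words over `A`. (A structure, so that it does not inherit the
lexicographic order of `List`.) -/
@[ext]
structure Word : Type where
  letters : List Letter
  deriving DecidableEq

namespace Word

/-- The length `|w|`. -/
def length (w : Word) : ℕ := w.letters.length

/-- Subword order: `u ≤ w` if `u` is obtained from `w` by deleting letters. -/
instance instPartialOrder : PartialOrder Word where
  le u w := u.letters.Sublist w.letters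
  le_refl u := List.Sublist.refl u.letters
  le_trans _ _ _ h₁ h₂ := List.Sublist.trans h₁ h₂
  le_antisymm _ _ h₁ h₂ := Word.ext (List.Sublist.antisymm h₁ h₂)

instance instDecidableLE : DecidableLE Word := fun u w =>
  inferInstanceAs (Decidable (u.letters.Sublist w.letters))

instance instLocallyFiniteOrder : LocallyFiniteOrder Word :=
  LocallyFiniteOrder.ofIcc Word
    (fun u w => ((w.letters.sublists.map Word.mk).toFinset).filter (fun v => u ≤ v ∧ v ≤ w))
    (by
      intro u w v
      simp only [Finset.mem_filter, List.mem_toFinset, List.mem_map, List.mem_sublists,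
        and_iff_right_iff_imp]
      exact fun h => ⟨v.letters, h.2, rfl⟩)

/-- The letter `w_i`, with positions numbered `1, …, |w|`; `none` at all other positions. -/
def letterAt (w : Word) : ℕ → Option Letter
  | 0 => none
  | i + 1 => w.letters[i]?

/-- The word `w_ι` formed by the letters of `w` whose positions lie in `ι`, from left to right. -/
def restrict (w : Word) (ι : Finset ℕ) : Word :=
  ⟨((w.letters.zipIdx 1).filter (fun p => p.2 ∈ ι)).map Prod.fst⟩

/-- `ι ⊆ {1, …, |w|}` is an embedding of `u` in `w`, that is, `w_ι = u`. -/
def IsEmbedding (u w : Word) (ι : Finset ℕ) : Prop :=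
  ι ⊆ Finset.Icc 1 w.length ∧ w.restrict ι = u

/-- `w` has no `d + 1` consecutive letters `b`. -/
def RunsLE (d : ℕ) (w : Word) : Prop :=
  ¬ List.replicate (d + 1) Letter.b <:+: w.letters

instance instDecidablePredRunsLE (d : ℕ) : DecidablePred (RunsLE d) := fun w =>
  inferInstanceAs (Decidable (¬ List.replicate (d + 1) Letter.b <:+: w.letters))

/-- The repetition set `R(w) = {j : w_j = w_{j-1}}`. -/
def repetitionSet (w : Word) : Finset ℕ :=
  (Finset.Icc 2 w.length).filter (fun j => w.letterAt j = w.letterAt (j - 1))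

/-- A run of `d` letters `b` of `u` starts at position `r`. For `d = 0` there is no such run with a
first letter in a word without letters `b`. -/
def BRunAt (d : ℕ) (u : Word) (r : ℕ) : Prop :=
  u.letterAt r = some Letter.b ∧ ∀ t < d, u.letterAt (r + t) = some Letter.b

/-- `d`-normal embeddings of `u` in `w`. For `p ∈ ι` the number `#{q ∈ ι : q ≤ p}` is the position
`j` of the letter `u_j` that is placed at `p`, so that `p = i_j`. -/
structure IsNormalEmbedding (d : ℕ) (u w : Word) (ι : Finset ℕ) : Prop where
  isEmbedding : IsEmbedding u w ι
  repetition : w.repetitionSet ⊆ ι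
  /-- A run of `d` letters `b` not at the beginning of `u` is placed directly behind a supported
  letter `a` of `w`. -/
  inner_run : ∀ p ∈ ι, 1 < (ι.filter (· ≤ p)).card → BRunAt d u (ι.filter (· ≤ p)).card →
    w.letterAt (p - 1) = some Letter.a ∧ p - 1 ∈ ι
  /-- A run of `d` letters `b` at the beginning of `u` is placed at the beginning of `w`, or
  directly behind an initial letter `a` of `w`. -/
  initial_run : ∀ p ∈ ι, (ι.filter (· ≤ p)).card = 1 → BRunAt d u 1 →
    p = 1 ∨ (p = 2 ∧ w.letterAt 1 = some Letter.a)

end Word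

/-- The subposet `A*_d` of `A*`: the words without `d + 1` consecutive letters `b`. -/
abbrev RestrictedWord (d : ℕ) : Type := {w : Word // Word.RunsLE d w}

/-! ### Dual CL-labelings of intervals -/

/-- `c = (x₀, x₁, …, x_k)` is a maximal chain of the interval `[u, w]`, listed from the top
`x₀ = w` to the bottom `x_k = u`. -/
def IsMaximalChain {α : Type*} [PartialOrder α] (u w : α) (c : List α) : Prop :=
  c.IsChain (fun x y => y ⋖ x) ∧ c.head? = some w ∧ c.getLast? = some u

/-- The part of the label sequence of the maximal chain `r ∪ m ∪ t` of `[u, w]` that belongs to the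
edges of `m`; here `r`, `m`, `t` are maximal chains of `[y, w]`, `[x, y]`, `[u, x]`. -/
def rootedLabels {α : Type*} (ℓ : List α → List ℤ) (r m t : List α) : List ℤ :=
  ((ℓ (r ++ m.tail ++ t.tail)).drop (r.length - 1)).take (m.length - 1)

/-- `ℓ`, which assigns to each maximal chain of `[u, w]` the sequence of the labels of its edges
read from top to bottom, is a dual CL-labeling of the (graded) interval `[u, w]`. -/
structure IsDualCLLabeling {α : Type*} [PartialOrder α] (u w : α) (ℓ : List α → List ℤ) :
    Prop where
  /-- All maximal chains have the same length. -/
  graded : ∀ c c', IsMaximalChain u w c → IsMaximalChain u w c' → c.length = c'.length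
  /-- There is one label for each edge. -/
  length_eq : ∀ c, IsMaximalChain u w c → (ℓ c).length = c.length - 1
  /-- If two maximal chains have the same first `s` edges from the top, then these edges have the
  same labels in both. -/
  prefix_eq : ∀ c c', IsMaximalChain u w c → IsMaximalChain u w c' →
    ∀ s, s < c.length → c.take (s + 1) = c'.take (s + 1) → (ℓ c).take s = (ℓ c').take s
  /-- Each rooted interval `[x, y]_r`, with root a maximal chain `r` of `[y, w]`, has a unique
  maximal chain `m` with weakly increasing labels, and the labels of `m` are lexicographically
  strictly smaller than those of all other maximal chains. By `prefix_eq` the labels do not depend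
  on the maximal chain `t` of `[u, x]` used to complete a chain. -/
  rooted : ∀ x y, u ≤ x → x ≤ y → y ≤ w → ∀ r t, IsMaximalChain y w r → IsMaximalChain u x t →
    ∃ m, IsMaximalChain x y m ∧ (rootedLabels ℓ r m t).Pairwise (· ≤ ·) ∧
      ∀ m', IsMaximalChain x y m' → m' ≠ m →
        ¬ (rootedLabels ℓ r m' t).Pairwise (· ≤ ·) ∧
        List.Lex (· < ·) (rootedLabels ℓ r m t) (rootedLabels ℓ r m' t)

/-- A poset is dual CL-shellable if each of its intervals has a dual CL-labeling. -/
def IsDualCLShellable (α : Type*) [PartialOrder α] : Prop :=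
  ∀ u w : α, u ≤ w → ∃ ℓ : List α → List ℤ, IsDualCLLabeling u w ℓ

/-! ### Shellability of order complexes -/

/-- The order complex of `[u, w]`: its faces are the non-empty finite chains of `[u, w]`. -/
def orderComplex {α : Type*} [PartialOrder α] (u w : α) : PreAbstractSimplicialComplex α where
  faces := {s | s.Nonempty ∧ (s : Set α) ⊆ Set.Icc u w ∧ IsChain (· ≤ ·) (s : Set α)}
  isRelLowerSet_faces := by
    intro s hs
    refine ⟨hs.1, fun t hts ht => ⟨ht, ?_, ?_⟩⟩
    · exact (Finset.coe_subset.mpr hts).trans hs.2.1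
    · exact hs.2.2.mono (Finset.coe_subset.mpr hts)

/-- A finite-dimensional pure complex with finitely many facets is shellable if its facets can be
listed as `F₁, …, F_n` such that for `i < j` there is `k < j` for which `F_k ∩ F_j` contains
`F_i ∩ F_j` and has one element less than `F_j`. -/
def IsShellable {α : Type*} [DecidableEq α] (K : PreAbstractSimplicialComplex α) : Prop :=
  (∀ s t, Maximal (· ∈ K) s → Maximal (· ∈ K) t → s.card = t.card) ∧
  ∃ (n : ℕ) (F : Fin n → Finset α), Function.Injective F ∧
    (∀ s, Maximal (· ∈ K) s ↔ ∃ i, F i = s) ∧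
    ∀ i j, i < j → ∃ k, k < j ∧ F i ∩ F j ⊆ F k ∩ F j ∧ (F k ∩ F j).card + 1 = (F j).card

/-! ### Björner's labeling -/

/-- Labels of the edges below a word that is embedded in `w` at the positions `S`: the first edge,
which leads down to `x`, has as label the least `i ∈ S` such that `S - {i}` is an embedding of `x`
in `w`, and the procedure goes on with `S - {i}`. -/
noncomputable def deletionLabels (w : Word) : Finset ℕ → List Word → List ℕ
  | _, [] => []
  | S, x :: xs =>
    let i := sInf {i : ℕ | i ∈ S ∧ Word.IsEmbedding x w (S.erase i)}
    i :: deletionLabels w (S.erase i) xs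

/-- Björner's labeling of the maximal chains `w = x₀, x₁, …` of intervals of `A*`, listed from top to
bottom. -/
noncomputable def bjornerLabeling : List Word → List ℤ
  | [] => []
  | w :: xs => (deletionLabels w (Finset.Icc 1 w.length) xs).map (fun i => (i : ℤ))

/-- The restriction of Björner's labeling to `A*_d`. -/
noncomputable def restrictedLabeling (d : ℕ) (c : List (RestrictedWord d)) : List ℤ :=
  bjornerLabeling (c.map Subtype.val)

/-- The maximal chains of the interval `[u, w]_d` of `A*_d` with strictly decreasing labels. -/
def descendingChains (d : ℕ) (u w : RestrictedWord d) : Set (List (RestrictedWord d)) :=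
  {c | IsMaximalChain u w c ∧ (restrictedLabeling d c).Pairwise (· > ·)}

/-! ### Maximal chains and facets of the order complex -/

/-! A saturated chain going down from `w` deletes one letter at a time. Within a run of equal
letters all deletions give the same word, and the least position is the head of the run. So such
chains amount to sequences of positions, each a run head at the moment of its deletion, and
Björner's labels are these positions (`isDeletion_deletionLabels`, `exists_deletionLabels_eq`,
`eq_of_deletionLabels_eq`).

Let `S` be the surviving positions and `x` a word below `w_S`. A weakly increasing deletion sequence
leading to `x` ends in an embedding in which no letter can move right inside its gap. There is
exactly one such embedding `T`, and it lies to the right of all others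
(`IsRightmost.card_filter_le`). Conversely, `S \ T` can be deleted from left to right, and no run of
more than `d` letters `b` arises on the way (`IsRightmost.runsLE_erase`); this is why the labeling
survives the restriction to `A*_d`. A first label smaller than `min (S \ T)` would contradict the
position of `T`, which gives lexicographic minimality (`IsRightmost.exists_isDeletion`). The first
step of this sequence also shows that covers in `A*_d` lose exactly one letter.

Two consequences hold for general dual CL-labelings. Ordering maximal chains lexicographically gives
a shelling, since a descent can be exchanged for an increasing step (`exists_adjacent`). For the
Möbius function, cut each chain into a decreasing and an increasing part: the signed count vanishes
(`sum_valley`), so signed numbers of decreasing chains satisfy the Möbius recursion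
(`mu_eq_ncard_descending`).

A decreasing chain deletes from right to left, so everything left of the current position is still
intact. Being a run head then becomes condition (a), and staying inside `A*_d` becomes (b) and (c)
(`isNormalEmbedding_iff`). -/

theorem IsMaximalChain.exists_cons {α : Type*} [PartialOrder α] {u w : α} {c : List α}
    (h : IsMaximalChain u w c) : ∃ xs, c = w :: xs := by
  obtain ⟨-, h, -⟩ := h
  cases c with
  | nil => simp at h
  | cons x xs =>
    simp only [List.head?_cons, Option.some.injEq] at h
    exact ⟨xs, by rw [h]⟩

theorem isMaximalChain_cons_iff {α : Type*} [PartialOrder α] {u w : α} {xs : List α} :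
    IsMaximalChain u w (w :: xs) ↔
      (w :: xs).IsChain (fun x y => y ⋖ x) ∧ (w :: xs).getLast (by simp) = u := by
  simp [IsMaximalChain, List.getLast?_eq_some_getLast]

section CL

variable {α : Type*} [PartialOrder α] {u w x y : α}

theorem isMaximalChain_append_cons_iff {p q : List α} :
    IsMaximalChain u w (p ++ x :: q) ↔
      IsMaximalChain x w (p ++ [x]) ∧ IsMaximalChain u x (x :: q) := by
  have h1 : (p ++ x :: q).head? = (p ++ [x]).head? := by cases p <;> simp
  have h2 : (p ++ x :: q).getLast? = (x :: q).getLast? := by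
    rw [List.getLast?_append_of_ne_nil _ (by simp)]
  have h3 : (p ++ [x]).getLast? = some x := by simp
  have h4 : (x :: q).head? = some x := rfl
  rw [IsMaximalChain, IsMaximalChain, IsMaximalChain, List.isChain_split, h1, h2]
  tauto

theorem IsMaximalChain.exists_append {c : List α} (h : IsMaximalChain u w c) :
    ∃ p, c = p ++ [u] := by
  obtain ⟨p, hp⟩ := List.getLast?_eq_some_iff.1 h.2.2
  exact ⟨p, hp⟩

theorem IsMaximalChain.append {r m : List α} (hr : IsMaximalChain y w r)
    (hm : IsMaximalChain x y m) : IsMaximalChain x w (r ++ m.tail) := by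
  obtain ⟨p, rfl⟩ := hr.exists_append
  obtain ⟨q, rfl⟩ := hm.exists_cons
  simpa using isMaximalChain_append_cons_iff.2 ⟨hr, hm⟩

theorem IsMaximalChain.pairwise {c : List α} (h : IsMaximalChain u w c) : c.Pairwise (· > ·) :=
  List.isChain_iff_pairwise.1 (h.1.imp fun _ _ hxy => hxy.lt)

theorem IsMaximalChain.nodup {c : List α} (h : IsMaximalChain u w c) : c.Nodup :=
  h.pairwise.imp fun hab => hab.ne'

theorem IsMaximalChain.mem_Icc {c : List α} (h : IsMaximalChain u w c) {z : α} (hz : z ∈ c) :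
    z ∈ Set.Icc u w := by
  have hp := h.pairwise
  constructor
  · obtain ⟨p, rfl⟩ := h.exists_append
    rw [List.pairwise_append] at hp
    rcases List.mem_append.1 hz with hz | hz
    · exact (hp.2.2 z hz u (by simp)).le
    · exact (List.mem_singleton.1 hz).ge
  · obtain ⟨q, rfl⟩ := h.exists_cons
    rcases List.mem_cons.1 hz with hz | hz
    · exact hz.le
    · exact ((List.pairwise_cons.1 hp).1 z hz).le

theorem IsMaximalChain.le {c : List α} (h : IsMaximalChain u w c) : u ≤ w := by
  obtain ⟨q, rfl⟩ := h.exists_cons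
  exact (h.mem_Icc (List.mem_cons_self ..)).1

theorem isMaximalChain_self_iff {c : List α} : IsMaximalChain u u c ↔ c = [u] := by
  constructor
  · intro h
    obtain ⟨q, rfl⟩ := h.exists_cons
    cases q with
    | nil => rfl
    | cons z q =>
      have h1 := (h.mem_Icc (z := z) (by simp)).1
      have h2 := (List.pairwise_cons.1 h.pairwise).1 z (by simp)
      exact absurd h1 (not_le_of_gt h2)
  · rintro rfl
    simp [IsMaximalChain]

/-- Walking down the chain, `z` eventually lies between two consecutive entries, and a cover leaves
no room strictly between them. -/
theorem IsMaximalChain.mem_of_comparable {c : List α} (h : IsMaximalChain u w c) {z : α}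
    (huz : u ≤ z) (hzw : z ≤ w) (hz : ∀ y ∈ c, y ≤ z ∨ z ≤ y) : z ∈ c := by
  obtain ⟨q, rfl⟩ := h.exists_cons
  induction q generalizing w with
  | nil =>
    have hw : w = u := by simpa [IsMaximalChain] using h
    simp [le_antisymm hzw (hw ▸ huz)]
  | cons x q ih =>
    have hs : IsMaximalChain u x (x :: q) :=
      (isMaximalChain_append_cons_iff (p := [w])).1 h |>.2
    have hc : x ⋖ w := (List.isChain_cons_cons.1 h.1).1
    rcases hz x (by simp) with hxz | hzx
    · rcases hc.eq_or_eq hxz hzw with rfl | rfl <;> simp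
    · exact List.mem_cons_of_mem _ (ih hzx hs fun y hy => hz y (List.mem_cons_of_mem _ hy))

variable [DecidableEq α]

theorem IsMaximalChain.maximal_toFinset {c : List α} (h : IsMaximalChain u w c) :
    Maximal (· ∈ orderComplex u w) c.toFinset := by
  refine ⟨⟨?_, ?_, ?_⟩, fun t ht hct z hz => ?_⟩
  · obtain ⟨q, rfl⟩ := h.exists_cons
    exact ⟨w, by simp⟩
  · intro z hz
    exact h.mem_Icc (by simpa using hz)
  · intro a ha b hb hab
    simp only [List.coe_toFinset, Set.mem_ofPred_eq] at ha hb
    have : Std.Symm fun a b : α => a ≤ b ∨ b ≤ a := ⟨fun _ _ => Or.symm⟩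
    exact (h.pairwise.imp fun {a b} hab => Or.inr (le_of_lt hab) :
      c.Pairwise fun a b => a ≤ b ∨ b ≤ a).forall ha hb hab
  · obtain ⟨-, hsub, hchain⟩ := ht
    rw [List.mem_toFinset]
    refine h.mem_of_comparable (hsub hz).1 (hsub hz).2 fun y hy => ?_
    exact hchain.total (hct (List.mem_toFinset.2 hy)) hz

theorem exists_pairwise_gt_toFinset_eq (s : Finset α) (hs : IsChain (· ≤ ·) (s : Set α)) :
    ∃ c : List α, c.Pairwise (· > ·) ∧ c.toFinset = s := by
  induction s using Finset.strongInduction with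
  | H s ih =>
    rcases s.eq_empty_or_nonempty with rfl | hne
    · exact ⟨[], by simp, rfl⟩
    · obtain ⟨m, hm⟩ := s.exists_maximal hne
      obtain ⟨c, hc, hcs⟩ := ih (s.erase m) (Finset.erase_ssubset hm.1)
        (hs.mono (Finset.coe_subset.2 (Finset.erase_subset _ _)))
      refine ⟨m :: c, List.pairwise_cons.2 ⟨fun z hz => ?_, hc⟩, ?_⟩
      · rw [← List.mem_toFinset, hcs, Finset.mem_erase] at hz
        refine lt_of_le_of_ne ?_ hz.1
        rcases hs.total hz.2 hm.1 with h | h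
        · exact h
        · exact hm.2 hz.2 h
      · rw [List.toFinset_cons, hcs, Finset.insert_erase hm.1]

/-- List the facet in decreasing order. By maximality it absorbs every element comparable to all its
members: `u`, `w`, and anything strictly between neighbours, so neighbours are covers. -/
theorem exists_isMaximalChain_of_maximal (huw : u ≤ w) {s : Finset α}
    (hs : Maximal (· ∈ orderComplex u w) s) : ∃ c, IsMaximalChain u w c ∧ c.toFinset = s := by
  obtain ⟨⟨hne, hsub, hchain⟩, hmax⟩ := hs
  have hins : ∀ z, u ≤ z → z ≤ w → (∀ y ∈ s, y ≤ z ∨ z ≤ y) → z ∈ s := by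
    intro z h1 h2 h3
    refine hmax (y := insert z s) ⟨⟨z, by simp⟩, ?_, ?_⟩ (Finset.subset_insert _ _)
      (Finset.mem_insert_self _ _)
    · rw [Finset.coe_insert]
      exact Set.insert_subset ⟨h1, h2⟩ hsub
    · rw [Finset.coe_insert]
      exact hchain.insert fun y hy _ => (h3 y hy).symm
  obtain ⟨c, hc, rfl⟩ := exists_pairwise_gt_toFinset_eq s hchain
  simp only [List.mem_toFinset] at hins hne
  have hsub' : ∀ z ∈ c, u ≤ z ∧ z ≤ w := fun z hz => hsub (List.mem_toFinset.2 hz)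
  have hw : w ∈ c := hins w huw le_rfl fun y hy => Or.inl (hsub' y hy).2
  have hu : u ∈ c := hins u le_rfl huw fun y hy => Or.inr (hsub' y hy).1
  refine ⟨c, ⟨?_, ?_, ?_⟩, rfl⟩
  · rw [List.isChain_iff_forall_rel_of_append_cons_cons]
    rintro a b l₁ l₂ rfl
    have hc' := hc
    simp only [List.pairwise_append, List.pairwise_cons, List.mem_cons] at hc
    have hab : b < a := hc.2.1.1 b (Or.inl rfl)
    refine ⟨hab, fun z hbz hza => ?_⟩
    have hz : z ∈ l₁ ++ a :: b :: l₂ := by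
      refine hins z ((hsub' b (by simp)).1.trans hbz.le) (hza.le.trans (hsub' a (by simp)).2)
        fun y hy => ?_
      simp only [List.mem_append, List.mem_cons] at hy
      rcases hy with hy | rfl | rfl | hy
      · exact Or.inr (hza.trans (hc.2.2 y hy a (Or.inl rfl))).le
      · exact Or.inr hza.le
      · exact Or.inl hbz.le
      · exact Or.inl ((hc.2.1.2.1 y hy).trans hbz).le
    simp only [List.mem_append, List.mem_cons] at hz
    rcases hz with hz | rfl | rfl | hz
    · exact lt_asymm hza (hc.2.2 z hz a (Or.inl rfl))
    · exact lt_irrefl _ hza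
    · exact lt_irrefl _ hbz
    · exact lt_asymm hbz (hc.2.1.2.1 z hz)
  · cases c with
    | nil => simp at hw
    | cons a c =>
      rcases List.mem_cons.1 hw with rfl | hw
      · rfl
      · exact absurd ((List.pairwise_cons.1 hc).1 w hw)
          (not_lt_of_ge (hsub' a (by simp)).2)
  · rcases List.eq_nil_or_concat c with rfl | ⟨c, a, rfl⟩
    · simp at hu
    · rw [List.concat_eq_append] at *
      rcases List.mem_append.1 hu with hu | hu
      · exact absurd ((List.pairwise_append.1 hc).2.2 u hu a (by simp))
          (not_lt_of_ge (hsub' a (by simp)).1)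
      · simp [List.mem_singleton.1 hu]

theorem IsMaximalChain.eq_of_toFinset_eq {c c' : List α} (h : IsMaximalChain u w c)
    (h' : IsMaximalChain u w c') (heq : c.toFinset = c'.toFinset) : c = c' :=
  List.Perm.eq_of_pairwise' h.pairwise h'.pairwise
    (List.perm_of_nodup_nodup_toFinset_eq h.nodup h'.nodup heq)

theorem finite_isMaximalChain [LocallyFiniteOrder α] (u w : α) :
    {c | IsMaximalChain u w c}.Finite := by
  refine Set.Finite.of_finite_image (f := List.toFinset)
    ((Finset.finite_toSet (Finset.Icc u w).powerset).subset ?_) fun c hc c' hc' h =>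
      hc.eq_of_toFinset_eq hc' h
  rintro _ ⟨c, hc, rfl⟩
  rw [Finset.mem_coe, Finset.mem_powerset]
  intro z hz
  exact Finset.mem_Icc.2 (hc.mem_Icc (List.mem_toFinset.1 hz))

end CL

section CL

/-! ### Shellability of intervals with a dual CL-labeling -/

theorem List.Lex.of_take {β : Type*} {r : β → β → Prop} {n : ℕ} {l l' : List β}
    (h : List.Lex r (l.take n) (l'.take n)) : List.Lex r l l' := by
  induction n generalizing l l' with
  | zero => simp at h
  | succ n ih =>
    cases l with
    | nil =>
      cases l' with
      | nil => simp at h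
      | cons b l' => exact List.Lex.nil
    | cons a l =>
      cases l' with
      | nil => simp at h
      | cons b l' =>
        simp only [List.take_succ_cons] at h
        cases h with
        | cons h => exact List.Lex.cons (ih h)
        | rel h => exact List.Lex.rel h

theorem List.Lex.of_drop {β : Type*} {r : β → β → Prop} {k : ℕ} {l l' : List β}
    (hk : l.take k = l'.take k) (h : List.Lex r (l.drop k) (l'.drop k)) : List.Lex r l l' := by
  rw [← List.take_append_drop k l, ← List.take_append_drop k l', hk]
  exact List.Lex.append_left _ h _

/-- Two different lists with the same first and the same last entry diverge at some `x`, and the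
second one meets the first one again at some `y`. -/
theorem List.exists_diverge {β : Type*} {a z : β} {l l' : List β} (hl : (a :: l).Nodup)
    (hl' : (a :: l').Nodup) (hz : (a :: l).getLast? = some z) (hz' : (a :: l').getLast? = some z)
    (hne : l ≠ l') : ∃ p x m y q m' q', a :: l = p ++ x :: (m ++ y :: q) ∧
      a :: l' = p ++ x :: (m' ++ y :: q') ∧ m ≠ m' ∧ ∀ k ∈ m', k ∉ a :: l := by
  have hnil : ∀ {b : β} {k : List β}, (b :: k).Nodup → (b :: k).getLast? = some b → k = [] := by
    intro b k hk hb
    cases k with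
    | nil => rfl
    | cons c k =>
      rw [List.getLast?_cons_cons] at hb
      exact absurd (List.mem_of_getLast? hb) (List.nodup_cons.1 hk).1
  induction l generalizing a l' with
  | nil =>
    obtain rfl : a = z := by simpa using hz
    exact absurd (hnil hl' hz').symm hne
  | cons b l ih =>
    cases l' with
    | nil =>
      obtain rfl : a = z := by simpa using hz'
      exact absurd (hnil hl hz) hne
    | cons b' l' =>
      rw [List.getLast?_cons_cons] at hz hz'
      by_cases hb : b = b'
      · subst hb
        obtain ⟨p, x, m, y, q, m', q', h1, h2, h3, h4⟩ := ih (List.nodup_cons.1 hl).2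
          (List.nodup_cons.1 hl').2 hz hz' fun e => hne (e ▸ rfl)
        refine ⟨a :: p, x, m, y, q, m', q', by rw [h1]; rfl, by rw [h2]; rfl, h3, fun k hk => ?_⟩
        rintro (_ | ⟨_, hk'⟩)
        · exact (List.nodup_cons.1 hl').1 (by rw [h2]; simp [hk])
        · exact h4 k hk hk'
      · classical
        have hex : ∃ k ∈ b' :: l', k ∈ b :: l :=
          ⟨z, List.mem_of_getLast? hz', List.mem_of_getLast? hz⟩
        obtain ⟨y, hy⟩ := Option.isSome_iff_exists.1
          (List.find?_isSome (xs := b' :: l') (p := fun k => decide (k ∈ b :: l)) |>.2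
            (by simpa only [decide_eq_true_eq] using hex))
        obtain ⟨hyl, m', q', hq', hm'⟩ := List.find?_eq_some_iff_append.1 hy
        obtain ⟨m, q, hq⟩ := List.append_of_mem (of_decide_eq_true hyl)
        have hm'' : ∀ k ∈ m', k ∉ b :: l := fun k hk => by simpa using hm' k hk
        refine ⟨[], a, m, y, q, m', q', by rw [hq]; rfl, by rw [hq']; rfl, ?_, fun k hk => ?_⟩
        · rintro rfl
          cases m with
          | nil =>
            simp only [List.nil_append, List.cons.injEq] at hq hq'
            exact hb (hq.1.trans hq'.1.symm)
          | cons c m => exact hm'' c (by simp) (by rw [hq]; simp)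
        · rintro (_ | ⟨_, hk'⟩)
          · exact (List.nodup_cons.1 hl').1 (by rw [hq']; simp [hk])
          · exact hm'' k hk hk'

variable {α : Type*} [PartialOrder α] {u w x y : α} {ℓ : List α → List ℤ}

namespace IsDualCLLabeling

/-- The edges of `m` lie above `x`, so `prefix_eq` makes their labels blind to the completion below
`x`. -/
theorem rootedLabels_congr (h : IsDualCLLabeling u w ℓ) {r m t t' : List α}
    (hr : IsMaximalChain y w r) (hm : IsMaximalChain x y m) (ht : IsMaximalChain u x t)
    (ht' : IsMaximalChain u x t') : rootedLabels ℓ r m t = rootedLabels ℓ r m t' := by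
  have h1 := (hr.append hm).append ht
  have h2 := (hr.append hm).append ht'
  have hpos : 0 < r.length := by
    obtain ⟨q, rfl⟩ := hr.exists_cons
    simp
  have hposm : m.tail.length = m.length - 1 := by simp
  have h3 := h.prefix_eq _ _ h1 h2 ((r ++ m.tail).length - 1) (by simp; omega) (by
    rw [Nat.sub_add_cancel (by simp; omega), List.take_left' rfl, List.take_left' rfl])
  have h4 := congrArg (List.drop (r.length - 1)) h3
  rw [List.drop_take, List.drop_take] at h4
  rw [rootedLabels, rootedLabels]
  convert h4 using 2 <;> simp <;> omega

/-- A strict comparison inside `[x, y]` decides the comparison of whole chains: the labels above `y`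
agree, and by gradedness both segments have equally many labels, so whatever follows below `x` is
irrelevant. -/
theorem lex_of_rootedLabels (h : IsDualCLLabeling u w ℓ) {r m m' t t' : List α}
    (hr : IsMaximalChain y w r) (hm : IsMaximalChain x y m) (hm' : IsMaximalChain x y m')
    (ht : IsMaximalChain u x t) (ht' : IsMaximalChain u x t')
    (hlex : List.Lex (· < ·) (rootedLabels ℓ r m t) (rootedLabels ℓ r m' t)) :
    List.Lex (· < ·) (ℓ (r ++ m.tail ++ t.tail)) (ℓ (r ++ m'.tail ++ t'.tail)) := by
  have hlen : m.length = m'.length := by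
    have := h.graded _ _ ((hr.append hm).append ht) ((hr.append hm').append ht)
    obtain ⟨q, rfl⟩ := hm.exists_cons
    obtain ⟨q', rfl⟩ := hm'.exists_cons
    simpa using this
  rw [h.rootedLabels_congr hr hm' ht ht', rootedLabels, rootedLabels, hlen] at hlex
  have hpos : 0 < r.length := by
    obtain ⟨q, rfl⟩ := hr.exists_cons
    simp
  refine List.Lex.of_drop (k := r.length - 1) ?_ hlex.of_take
  refine h.prefix_eq _ _ ((hr.append hm).append ht) ((hr.append hm').append ht') _
    (by simp; omega) ?_
  rw [Nat.sub_add_cancel (by omega), List.append_assoc, List.append_assoc, List.take_left' rfl,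
    List.take_left' rfl]

/-- A maximal chain with a descent at `f` can be replaced by a lexicographically smaller one that
differs from it only at `f`. -/
theorem exists_swap (h : IsDualCLLabeling u w ℓ) {P Q : List α} {e f g : α}
    (hc : IsMaximalChain u w (P ++ e :: f :: g :: Q)) {A B : List ℤ} {a b : ℤ}
    (hL : ℓ (P ++ e :: f :: g :: Q) = A ++ a :: b :: B) (hA : A.length = P.length) (hab : b < a) :
    ∃ f', f' ≠ f ∧ IsMaximalChain u w (P ++ e :: f' :: g :: Q) ∧
      List.Lex (· < ·) (ℓ (P ++ e :: f' :: g :: Q)) (ℓ (P ++ e :: f :: g :: Q)) := by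
  obtain ⟨hr, hrest⟩ := isMaximalChain_append_cons_iff.1 hc
  obtain ⟨hm, ht⟩ := (isMaximalChain_append_cons_iff (p := [e, f]) (x := g)).1 hrest
  simp only [List.cons_append, List.nil_append] at hm
  obtain ⟨m, hmax, hinc, huniq⟩ := h.rooted g e ht.le hm.le hr.le _ _ hr ht
  have hlab : rootedLabels ℓ (P ++ [e]) [e, f, g] (g :: Q) = [a, b] := by
    simp [rootedLabels, hL, List.drop_left' hA]
  -- The descent `b < a` prevents the given two-step chain from being the increasing one.
  have hne : [e, f, g] ≠ m := by
    rintro rfl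
    rw [hlab] at hinc
    simp at hinc
    omega
  have hlex := h.lex_of_rootedLabels hr hmax hm ht ht (huniq _ hm hne).2
  have hlen := h.graded _ _ ((hr.append hmax).append ht) ((hr.append hm).append ht)
  obtain ⟨q, rfl⟩ := hmax.exists_cons
  have hq2 : q.length = 2 := by
    simp at hlen
    omega
  obtain ⟨f', g', rfl⟩ := List.length_eq_two.1 hq2
  obtain rfl : g' = g := by
    have := hmax.2.2
    simpa using this
  refine ⟨f', fun hf => hne (by rw [hf]), ?_, by simpa using hlex⟩
  simpa using (hr.append hmax).append ht

/-- Let `c'` leave `c` at `x` and first return at `y`. If its labels in between were weakly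
increasing, `c'` would precede `c`, against the hypothesis. So there is a descent at some `f`
strictly between `x` and `y`, hence off `c`, and the swap at `f` yields an earlier chain. -/
theorem exists_adjacent (h : IsDualCLLabeling u w ℓ) {c c' : List α} (hc : IsMaximalChain u w c)
    (hc' : IsMaximalChain u w c') (hne : c ≠ c') (hlex : ¬ List.Lex (· < ·) (ℓ c') (ℓ c)) :
    ∃ P e f f' g Q, f' ≠ f ∧ f ∉ c ∧ c' = P ++ e :: f :: g :: Q ∧
      IsMaximalChain u w (P ++ e :: f' :: g :: Q) ∧
      List.Lex (· < ·) (ℓ (P ++ e :: f' :: g :: Q)) (ℓ c') := by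
  obtain ⟨xs, rfl⟩ := hc.exists_cons
  obtain ⟨xs', rfl⟩ := hc'.exists_cons
  obtain ⟨p, x, m, y, q, m', q', h1, h2, hmm, hdisj⟩ := List.exists_diverge hc.nodup hc'.nodup
    hc.2.2 hc'.2.2 fun e => hne (e ▸ rfl)
  rw [h1] at hc hlex hdisj
  rw [h2] at hc' hlex
  rw [h2, h1]
  obtain ⟨hr, hrest⟩ := isMaximalChain_append_cons_iff.1 hc
  obtain ⟨-, hrest'⟩ := isMaximalChain_append_cons_iff.1 hc'
  obtain ⟨hm, ht⟩ := (isMaximalChain_append_cons_iff (p := x :: m) (x := y)).1 hrest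
  obtain ⟨hm', ht'⟩ := (isMaximalChain_append_cons_iff (p := x :: m') (x := y)).1 hrest'
  have hnot : ¬ (rootedLabels ℓ (p ++ [x]) (x :: m' ++ [y]) (y :: q')).Pairwise (· ≤ ·) := by
    intro hinc
    obtain ⟨m₀, hmax, -, huniq⟩ := h.rooted y x ht.le hm.le hr.le _ _ hr ht'
    have hm₀ : x :: m' ++ [y] = m₀ := by
      by_contra hcon
      exact (huniq _ hm' hcon).1 hinc
    subst hm₀
    have := h.lex_of_rootedLabels hr hm' hm ht' ht (huniq _ hm (by simpa using hmm)).2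
    exact hlex (by simpa using this)
  rw [← List.isChain_iff_pairwise, List.isChain_iff_forall_rel_of_append_cons_cons] at hnot
  push Not at hnot
  obtain ⟨a, b, B₁, B₂, hB, hba⟩ := hnot
  have hlen := h.length_eq _ hc'
  have hroot : rootedLabels ℓ (p ++ [x]) (x :: m' ++ [y]) (y :: q') =
      ((ℓ (p ++ x :: (m' ++ y :: q'))).drop p.length).take (m'.length + 1) := by
    simp [rootedLabels]
  rw [hroot] at hB
  have hB' := congrArg List.length hB
  simp only [List.length_take, List.length_drop, hlen, List.length_append, List.length_cons] at hB'
  have hL : ℓ (p ++ x :: (m' ++ y :: q')) = ((ℓ (p ++ x :: (m' ++ y :: q'))).take p.length ++ B₁) ++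
      a :: b :: (B₂ ++ ((ℓ (p ++ x :: (m' ++ y :: q'))).drop p.length).drop (m'.length + 1)) := by
    conv_lhs => rw [← List.take_append_drop p.length (ℓ (p ++ x :: (m' ++ y :: q'))),
      ← List.take_append_drop (m'.length + 1) ((ℓ (p ++ x :: (m' ++ y :: q'))).drop p.length), hB]
    simp
  -- The descent sits strictly between the two common elements.
  obtain ⟨M₁, f, M₂, hM, hM₁⟩ : ∃ M₁ f M₂, m' = M₁ ++ f :: M₂ ∧ M₁.length = B₁.length := by
    have hlt : B₁.length < m'.length := by omega
    refine ⟨m'.take B₁.length, m'[B₁.length], m'.drop (B₁.length + 1), ?_, by simp; omega⟩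
    simp
  subst hM
  obtain ⟨E, e, hE⟩ : ∃ E e, x :: M₁ = E ++ [e] := by
    rcases List.eq_nil_or_concat (x :: M₁) with hnil | ⟨E, e, hE⟩
    · simp at hnil
    · exact ⟨E, e, by rw [hE, List.concat_eq_append]⟩
  obtain ⟨g, G, hG⟩ : ∃ g G, M₂ ++ y :: q' = g :: G := by
    cases M₂ with
    | nil => exact ⟨_, _, rfl⟩
    | cons g M => exact ⟨_, _, rfl⟩
  have hshape : p ++ x :: (M₁ ++ f :: M₂ ++ y :: q') = (p ++ E) ++ e :: f :: g :: G := by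
    have : p ++ x :: (M₁ ++ f :: M₂ ++ y :: q') = p ++ (x :: M₁) ++ f :: (M₂ ++ y :: q') := by simp
    rw [this, hE, hG]
    simp
  have hElen : E.length = B₁.length := by
    have := congrArg List.length hE
    simp at this
    omega
  rw [hshape] at hL hc' ⊢
  obtain ⟨f', hf', hmax, hlex'⟩ := h.exists_swap hc' hL (by
    simp only [List.length_append, List.length_take, hElen]
    rw [hshape] at hlen
    simp only [hlen, List.length_append, List.length_cons]
    omega) hba
  exact ⟨p ++ E, e, f, f', g, G, hf', hdisj f (by simp), rfl, hmax, hlex'⟩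

theorem isShellable [LocallyFiniteOrder α] [DecidableEq α] (h : IsDualCLLabeling u w ℓ)
    (huw : u ≤ w) : IsShellable (orderComplex u w) := by
  classical
  refine ⟨fun s t hs ht => ?_, ?_⟩
  · obtain ⟨c, hc, rfl⟩ := exists_isMaximalChain_of_maximal huw hs
    obtain ⟨c', hc', rfl⟩ := exists_isMaximalChain_of_maximal huw ht
    rw [List.toFinset_card_of_nodup hc.nodup, List.toFinset_card_of_nodup hc'.nodup]
    exact h.graded c c' hc hc'
  -- Ties may be broken arbitrarily: `exists_adjacent` only needs that `c'` is not strictly smaller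
  -- than `c`, and returns a chain strictly smaller than `c'`.
  let r : List α → List α → Prop := fun c c' => ℓ c ≤ ℓ c'
  have : Std.Total r := ⟨fun c c' => le_total (ℓ c) (ℓ c')⟩
  have : IsTrans (List α) r := ⟨fun _ _ _ => le_trans⟩
  let L := ((finite_isMaximalChain u w).toFinset.toList).insertionSort r
  have hLsorted : L.Pairwise r := List.pairwise_insertionSort r _
  have hLperm := List.perm_insertionSort r ((finite_isMaximalChain u w).toFinset.toList)
  have hLmem : ∀ c, c ∈ L ↔ IsMaximalChain u w c := by
    intro c
    rw [hLperm.mem_iff]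
    simp
  have hLnodup : L.Nodup := hLperm.nodup_iff.2 (Finset.nodup_toList _)
  have hget : ∀ i : Fin L.length, IsMaximalChain u w (L.get i) := fun i =>
    (hLmem _).1 (List.get_mem L i)
  refine ⟨L.length, fun i => (L.get i).toFinset, fun i j hij => ?_, fun s => ⟨fun hs => ?_, ?_⟩, ?_⟩
  · exact (List.nodup_iff_injective_get.1 hLnodup) ((hget i).eq_of_toFinset_eq (hget j) hij)
  · obtain ⟨c, hc, rfl⟩ := exists_isMaximalChain_of_maximal huw hs
    obtain ⟨i, hi⟩ := List.get_of_mem ((hLmem c).2 hc)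
    exact ⟨i, congrArg List.toFinset hi⟩
  · rintro ⟨i, rfl⟩
    exact (hget i).maximal_toFinset
  · intro i j hij
    have hle : ℓ (L.get i) ≤ ℓ (L.get j) := List.pairwise_iff_get.1 hLsorted i j hij
    obtain ⟨P, e, f, f', g, Q, hff, hfc, hc', hmax, hlex⟩ := h.exists_adjacent (hget i) (hget j)
      (fun e => hij.ne ((List.nodup_iff_injective_get.1 hLnodup) e)) (not_lt_of_ge hle)
    obtain ⟨k, hk⟩ := List.get_of_mem ((hLmem _).2 hmax)
    have hkj : k < j := by
      by_contra! hjk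
      have : ℓ (L.get j) ≤ ℓ (L.get k) := by
        rcases hjk.eq_or_lt with rfl | hlt
        · exact le_rfl
        · exact List.pairwise_iff_get.1 hLsorted j k hlt
      rw [hk] at this
      exact not_lt_of_ge this hlex
    have hnodup : (P ++ e :: f :: g :: Q).Nodup := hc' ▸ (hget j).nodup
    have hinter : (L.get k).toFinset ∩ (L.get j).toFinset = (L.get j).toFinset.erase f := by
      rw [hk, hc']
      ext z
      simp only [Finset.mem_inter, Finset.mem_erase, List.mem_toFinset, List.mem_append,
        List.mem_cons]
      simp only [List.nodup_append, List.nodup_cons, List.mem_cons] at hnodup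
      constructor
      · rintro ⟨h1, h2⟩
        refine ⟨?_, h2⟩
        rintro rfl
        rcases h1 with h1 | h1 | h1 | h1 | h1
        · exact hnodup.2.2 z h1 z (by simp) rfl
        · exact hnodup.2.1.1 (by simp [h1])
        · exact hff h1.symm
        · exact hnodup.2.1.2.1 (by simp [h1])
        · exact hnodup.2.1.2.1 (by simp [h1])
      · rintro ⟨h1, h2⟩
        tauto
    have hfj : f ∈ (L.get j).toFinset := by
      rw [hc']
      simp
    refine ⟨k, hkj, ?_, ?_⟩
    · simp only [hinter]
      intro z hz
      rw [Finset.mem_inter] at hz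
      refine Finset.mem_erase.2 ⟨?_, hz.2⟩
      rintro rfl
      exact hfc (List.mem_toFinset.1 hz.1)
    · simp only [hinter]
      exact Finset.card_erase_add_one hfj

end IsDualCLLabeling

end CL

/-! ### The Möbius function of a poset with a dual CL-labeling -/

/-- Cutting a list into a strictly decreasing and a weakly increasing part is possible in two ways
or in none, which differ by one in the position of the cut. -/
theorem sum_valley (L : List ℤ) (hL : L ≠ []) :
    ∑ k ∈ Finset.range (L.length + 1),
      (if (L.take k).Pairwise (· > ·) ∧ (L.drop k).Pairwise (· ≤ ·) then (-1 : ℤ) ^ k else 0) =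
        0 := by
  induction L with
  | nil => exact absurd rfl hL
  | cons a L ih =>
    rw [Finset.sum_range_succ']
    cases L with
    | nil => simp
    | cons b L =>
      -- With an initial descent the cut at 0 is impossible and the other cuts are those of the tail
      -- with opposite sign. Without it only the cuts at 0 and 1 can occur; their conditions
      -- coincide and their signs are opposite.
      rcases lt_or_ge b a with hba | hab
      · have hdec : ∀ k, ((a :: b :: L).take (k + 1)).Pairwise (· > ·) ↔
            ((b :: L).take k).Pairwise (· > ·) := by
          intro k
          cases k with
          | zero => simp
          | succ k =>
            simp only [List.take_succ_cons]
            rw [← List.isChain_iff_pairwise, ← List.isChain_iff_pairwise, List.isChain_cons_cons]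
            exact and_iff_right hba
        have hinc : ¬ (a :: b :: L).Pairwise (· ≤ ·) := fun h =>
          absurd ((List.pairwise_cons.1 h).1 b (by simp)) (not_le.2 hba)
        simp only [hdec, List.drop_succ_cons, List.drop_zero, hinc, and_false, if_false, add_zero]
        rw [← neg_eq_zero, ← Finset.sum_neg_distrib]
        refine (Finset.sum_congr rfl fun k _ => ?_).trans (ih (by simp))
        split_ifs <;> simp [pow_succ]
      · have hdec : ∀ k, ¬ ((a :: b :: L).take (k + 1 + 1)).Pairwise (· > ·) := fun k h =>
          absurd ((List.pairwise_cons.1 h).1 b (by simp)) (not_lt.2 hab)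
        have hinc : (a :: b :: L).Pairwise (· ≤ ·) ↔ (b :: L).Pairwise (· ≤ ·) := by
          rw [← List.isChain_iff_pairwise, ← List.isChain_iff_pairwise, List.isChain_cons_cons]
          exact and_iff_right hab
        rw [List.length_cons, Finset.sum_range_succ']
        simp only [hdec, false_and, if_false, Finset.sum_const_zero, zero_add]
        simp only [List.take_succ_cons, List.take_zero, List.drop_succ_cons, List.drop_zero, hinc,
          List.Pairwise.nil, true_and,
          List.pairwise_singleton]
        split_ifs <;> simp

section CL

variable {α : Type*} [PartialOrder α] {u w x y : α} {ℓ : List α → List ℤ}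

theorem IsMaximalChain.rank_eq {ρ : α → ℕ} (hρ : ∀ x y : α, x ⋖ y → ρ x + 1 = ρ y) {c : List α}
    (h : IsMaximalChain u w c) : ρ w + 1 = ρ u + c.length := by
  obtain ⟨q, rfl⟩ := h.exists_cons
  induction q generalizing w with
  | nil =>
    have hw : w = u := by simpa [IsMaximalChain] using h
    simp [hw]
  | cons x q ih =>
    have hs : IsMaximalChain u x (x :: q) :=
      ((isMaximalChain_append_cons_iff (p := [w])).1 h).2
    have h1 := hρ _ _ (List.isChain_cons_cons.1 h.1).1
    have h2 := ih hs
    simp only [List.length_cons] at h2 ⊢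
    omega

/-- The maximal chains of `[u, w]` with strictly decreasing labels. -/
def descending (ℓ : List α → List ℤ) (u w : α) : Set (List α) :=
  {c | IsMaximalChain u w c ∧ (ℓ c).Pairwise (· > ·)}

theorem IsMaximalChain.take_drop {C : List α} (h : IsMaximalChain u w C) {k : ℕ}
    (hk : k < C.length) : IsMaximalChain C[k] w (C.take (k + 1)) ∧
      IsMaximalChain u C[k] (C.drop k) := by
  have hc : C = C.take k ++ C[k] :: C.drop (k + 1) := by simp
  rw [hc, isMaximalChain_append_cons_iff] at h
  simpa using h

/-- The strictly decreasing maximal chains of `[x, w]` correspond to the maximal chains of `[u, w]`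
whose labels are strictly decreasing above `x` and weakly increasing below `x`. -/
theorem IsDualCLLabeling.ncard_descending (h : IsDualCLLabeling u w ℓ)
    (hpre : ∀ C t : List α, C ≠ [] → (ℓ (C ++ t)).take (C.length - 1) = ℓ C)
    (hux : u ≤ x) (hxw : x ≤ w) :
    {p : List α × ℕ | IsMaximalChain u w p.1 ∧ p.1[p.2]? = some x ∧
      ((ℓ p.1).take p.2).Pairwise (· > ·) ∧ ((ℓ p.1).drop p.2).Pairwise (· ≤ ·)}.ncard =
      (descending ℓ x w).ncard := by
  have hself : IsMaximalChain u u [u] := isMaximalChain_self_iff.2 rfl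
  have hroot : ∀ r m, IsMaximalChain x w r → IsMaximalChain u x m →
      rootedLabels ℓ r m [u] = (ℓ (r ++ m.tail)).drop (r.length - 1) := by
    intro r m hr hm
    have hlen := h.length_eq _ (hr.append hm)
    simp only [rootedLabels, List.tail_cons, List.append_nil]
    rw [List.take_of_length_le]
    simp [hlen]
    omega
  have hlabels : ∀ {C : List α} {k : ℕ}, k < C.length → (ℓ C).take k = ℓ (C.take (k + 1)) := by
    intro C k hk
    have := hpre (C.take (k + 1)) (C.drop (k + 1)) (by
      intro he
      simp only [List.take_eq_nil_iff, Nat.add_eq_zero_iff, one_ne_zero, and_false, false_or] at he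
      simp [he] at hk)
    rw [List.take_append_drop, List.length_take, Nat.min_eq_left (by omega),
      Nat.add_sub_cancel] at this
    exact this
  refine Set.ncard_congr (fun p _ => p.1.take (p.2 + 1)) ?_ ?_ ?_
  · rintro ⟨C, k⟩ ⟨hc, hCk, hdec, -⟩
    obtain ⟨hk, rfl⟩ := List.getElem?_eq_some_iff.1 hCk
    exact ⟨(hc.take_drop hk).1, hlabels hk ▸ hdec⟩
  · rintro ⟨C, k⟩ ⟨C', k'⟩ ⟨hc, hCk, -, hinc⟩ ⟨hc', hCk', -, hinc'⟩ heq
    dsimp only at *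
    obtain ⟨hk, rfl⟩ := List.getElem?_eq_some_iff.1 hCk
    obtain ⟨hk', hx⟩ := List.getElem?_eq_some_iff.1 hCk'
    have hkk : k = k' := by
      have := congrArg List.length heq
      simp at this
      omega
    subst hkk
    obtain ⟨hr, hm⟩ := hc.take_drop hk
    obtain ⟨hr', hm'⟩ := hc'.take_drop hk'
    rw [hx] at hr' hm'
    have hlen : (C.take (k + 1)).length - 1 = k := by simp; omega
    -- Injectivity: below the cut, both chains must follow the unique increasing chain for the
    -- common root.
    obtain ⟨m, -, -, huniq⟩ := h.rooted u C[k] le_rfl hux hxw _ _ hr hself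
    have key : ∀ m', IsMaximalChain u C[k] m' →
        ((ℓ (C.take (k + 1) ++ m'.tail)).drop k).Pairwise (· ≤ ·) → m' = m := by
      intro m' hm' hp
      by_contra hne
      refine (huniq m' hm' hne).1 ?_
      rwa [hroot _ _ hr hm', hlen]
    have h1 := key _ hm (by simpa using hinc)
    have h2 := key _ hm' (by rw [heq]; simpa using hinc')
    have h3 : C = C' := by
      rw [← List.take_append_drop (k + 1) C, ← List.take_append_drop (k + 1) C', heq,
        ← List.tail_drop, ← List.tail_drop, h1, h2]
    rw [h3]
  · rintro r ⟨hr, hdec⟩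
    obtain ⟨m, hm, hinc, -⟩ := h.rooted u x le_rfl hux hxw _ _ hr hself
    rw [hroot r m hr hm] at hinc
    obtain ⟨p, rfl⟩ := hr.exists_append
    have hr' := hpre (p ++ [x]) m.tail (by simp)
    refine ⟨(p ++ [x] ++ m.tail, p.length), ⟨hr.append hm, by simp, ?_, by simpa using hinc⟩, ?_⟩
    · simp only [List.length_append, List.length_singleton, Nat.add_sub_cancel] at hr'
      rw [hr']
      exact hdec
    · dsimp only
      rw [List.take_left' (by simp)]

variable [LocallyFiniteOrder α] [DecidableEq α]

/-- Count pairs of a maximal chain of `[u, w]` and a cut `k`, decreasing above and increasing below,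
with sign `(-1) ^ k`. Summed chain by chain this is zero by `sum_valley`, as `u < w` provides a
label. Grouped by the element `x` at the cut, `ncard_descending` gives the terms of the sum. -/
theorem IsDualCLLabeling.sum_descending (h : IsDualCLLabeling u w ℓ)
    (hpre : ∀ c t : List α, c ≠ [] → (ℓ (c ++ t)).take (c.length - 1) = ℓ c)
    {ρ : α → ℕ} (hρ : ∀ x y : α, x ⋖ y → ρ x + 1 = ρ y) (huw : u < w) :
    ∑ x ∈ Finset.Icc u w, (-1 : ℤ) ^ (ρ w + ρ x) * ((descending ℓ x w).ncard : ℤ) = 0 := by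
  classical
  set MC := (finite_isMaximalChain u w).toFinset with hMC
  have hmem : ∀ c, c ∈ MC ↔ IsMaximalChain u w c := by simp [hMC]
  have hlen : ∀ c, IsMaximalChain u w c → c.length = ρ w - ρ u + 1 := fun c hc => by
    have h1 := hc.rank_eq hρ
    have : c.length ≠ 0 := by
      obtain ⟨q, rfl⟩ := hc.exists_cons
      simp
    omega
  set E := (MC ×ˢ Finset.range (ρ w - ρ u + 1)).filter fun p : List α × ℕ =>
    ((ℓ p.1).take p.2).Pairwise (· > ·) ∧ ((ℓ p.1).drop p.2).Pairwise (· ≤ ·) with hE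
  have hzero : ∑ p ∈ E, (-1 : ℤ) ^ p.2 = 0 := by
    rw [hE, Finset.sum_filter, Finset.sum_product]
    refine Finset.sum_eq_zero fun c hc => ?_
    rw [hmem] at hc
    have hl := h.length_eq c hc
    have hn := hlen c hc
    have hne : ℓ c ≠ [] := by
      intro he
      rw [he] at hl
      obtain ⟨q, rfl⟩ := hc.exists_cons
      obtain rfl : q = [] := by simpa using hl.symm
      have : w = u := by simpa [IsMaximalChain] using hc
      exact huw.ne this.symm
    have := sum_valley (ℓ c) hne
    rwa [hl, hn, Nat.add_sub_cancel] at this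
  -- The default `w` never matters: cuts in `E` are valid indices.
  have hmaps : ∀ p ∈ E, (p.1[p.2]?).getD w ∈ Finset.Icc u w := by
    intro p hp
    simp only [hE, Finset.mem_filter, Finset.mem_product, hmem, Finset.mem_range] at hp
    have hk : p.2 < p.1.length := by
      rw [hlen _ hp.1.1]
      exact hp.1.2
    rw [List.getElem?_eq_getElem hk, Option.getD_some, Finset.mem_Icc]
    exact hp.1.1.mem_Icc (List.getElem_mem hk)
  rw [← hzero, ← Finset.sum_fiberwise_of_maps_to hmaps]
  refine Finset.sum_congr rfl fun x hx => ?_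
  rw [Finset.mem_Icc] at hx
  have hfiber : ∀ p, p ∈ E.filter (fun p => (p.1[p.2]?).getD w = x) ↔
      IsMaximalChain u w p.1 ∧ p.1[p.2]? = some x ∧
      ((ℓ p.1).take p.2).Pairwise (· > ·) ∧ ((ℓ p.1).drop p.2).Pairwise (· ≤ ·) := by
    intro p
    simp only [hE, Finset.mem_filter, Finset.mem_product, hmem, Finset.mem_range]
    constructor
    · rintro ⟨⟨⟨h1, h2⟩, h3⟩, h4⟩
      have hk : p.2 < p.1.length := by rw [hlen _ h1]; exact h2
      rw [List.getElem?_eq_getElem hk, Option.getD_some] at h4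
      exact ⟨h1, by rw [List.getElem?_eq_getElem hk, h4], h3⟩
    · rintro ⟨h1, h2, h3⟩
      have hk := (List.getElem?_eq_some_iff.1 h2).1
      rw [hlen _ h1] at hk
      exact ⟨⟨⟨h1, hk⟩, h3⟩, by rw [h2, Option.getD_some]⟩
  have hsign : ∀ p ∈ E.filter (fun p => (p.1[p.2]?).getD w = x),
      (-1 : ℤ) ^ p.2 = (-1) ^ (ρ w + ρ x) := by
    intro p hp
    obtain ⟨h1, h2, -⟩ := (hfiber p).1 hp
    obtain ⟨hk, hkx⟩ := List.getElem?_eq_some_iff.1 h2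
    have h3 := (h1.take_drop hk).1.rank_eq hρ
    rw [List.length_take, Nat.min_eq_left (by omega), hkx] at h3
    rw [show ρ w + ρ x = p.2 + 2 * ρ x by omega, pow_add, pow_mul]
    simp
  rw [Finset.sum_congr rfl hsign, Finset.sum_const, nsmul_eq_mul, mul_comm,
    ← h.ncard_descending hpre hx.1 hx.2, ← Set.ncard_coe_finset]
  congr 3
  ext p
  rw [Finset.mem_coe, hfiber]
  rfl

/-- Both sides sum to zero over `x ∈ [u, w]` when `u < w`. By induction on the size of the interval
they agree for `x ≠ u`, hence also for `x = u`. -/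
theorem mu_eq_ncard_descending (h : ∀ u w : α, u ≤ w → IsDualCLLabeling u w ℓ)
    (hpre : ∀ c t : List α, c ≠ [] → (ℓ (c ++ t)).take (c.length - 1) = ℓ c)
    {ρ : α → ℕ} (hρ : ∀ x y : α, x ⋖ y → ρ x + 1 = ρ y) (u w : α) :
    IncidenceAlgebra.mu ℤ u w = (-1) ^ (ρ w + ρ u) * ((descending ℓ u w).ncard : ℤ) := by
  by_cases huw : u ≤ w
  · induction hn : (Finset.Icc u w).card using Nat.strong_induction_on generalizing u with
    | _ n ih =>
    rcases huw.eq_or_lt with rfl | hlt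
    · have hset : descending ℓ u u = {[u]} := by
        ext c
        simp only [descending, Set.mem_ofPred_eq, isMaximalChain_self_iff, Set.mem_singleton_iff,
          and_iff_left_iff_imp]
        rintro rfl
        have := (h u u le_rfl).length_eq [u] (isMaximalChain_self_iff.2 rfl)
        have hnil : ℓ [u] = [] := List.length_eq_zero_iff.1 (by simpa using this)
        rw [hnil]
        exact List.Pairwise.nil
      rw [IncidenceAlgebra.mu_self, hset, Set.ncard_singleton, ← two_mul, pow_mul]
      simp
    · have h1 := IncidenceAlgebra.sum_Icc_mu_left (𝕜 := ℤ) u w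
      have h2 := (h u w huw).sum_descending hpre hρ hlt
      rw [if_neg hlt.ne, ← h2] at h1
      rw [Finset.Icc_eq_cons_Ioc huw, Finset.sum_cons, Finset.sum_cons] at h1
      have h3 : ∑ x ∈ Finset.Ioc u w, IncidenceAlgebra.mu ℤ x w =
          ∑ x ∈ Finset.Ioc u w, (-1 : ℤ) ^ (ρ w + ρ x) * ((descending ℓ x w).ncard : ℤ) := by
        refine Finset.sum_congr rfl fun x hx => ?_
        rw [Finset.mem_Ioc] at hx
        refine ih _ ?_ x hx.2 rfl
        rw [← hn]
        exact Finset.card_lt_card (Finset.Icc_ssubset_Icc_left huw hx.1 le_rfl)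
      rw [h3] at h1
      exact add_right_cancel h1
  · rw [IncidenceAlgebra.apply_eq_zero_of_not_le huw]
    have hset : descending ℓ u w = ∅ := by
      ext c
      simp only [Set.mem_empty_iff_false, iff_false]
      exact fun hc => huw hc.1.le
    simp [hset]

end CL

/-! ### Subwords as restrictions to sets of positions -/

theorem List.SortedLT.sort_toFinset {l : List ℕ} (h : l.SortedLT) : l.toFinset.sort = l :=
  (List.toFinset_sort (r := (· ≤ ·)) h.nodup).2 h.sortedLE.pairwise

namespace Finset

theorem sort_union_of_lt {s t : Finset ℕ} (h : ∀ x ∈ s, ∀ y ∈ t, x < y) :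
    (s ∪ t).sort = s.sort ++ t.sort := by
  have hs : (s.sort ++ t.sort).SortedLT := by
    rw [List.sortedLT_iff_pairwise, List.pairwise_append]
    refine ⟨(sortedLT_sort s).pairwise, (sortedLT_sort t).pairwise, ?_⟩
    simpa using h
  have := hs.sort_toFinset
  rwa [List.toFinset_append, sort_toFinset, sort_toFinset] at this

end Finset

namespace Word

variable {w x : Word} {S T : Finset ℕ}

theorem letterAt_mem_zipIdx {p : Letter × ℕ} (hp : p ∈ w.letters.zipIdx 1) :
    w.letterAt p.2 = some p.1 ∧ p.2 ∈ Finset.Icc 1 w.length := by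
  obtain ⟨c, i⟩ := p
  obtain ⟨h1, h2⟩ := List.mk_mem_zipIdx_iff_le_and_getElem?_sub.1 hp
  obtain ⟨j, rfl⟩ := Nat.exists_eq_add_of_le' h1
  simp only [Nat.add_sub_cancel] at h2
  refine ⟨h2, ?_⟩
  have := (List.getElem?_eq_some_iff.1 h2).1
  simp only [Finset.mem_Icc, length]
  omega

theorem exists_mem_zipIdx {i : ℕ} (hi : i ∈ Finset.Icc 1 w.length) :
    ∃ c, (c, i) ∈ w.letters.zipIdx 1 := by
  simp only [Finset.mem_Icc, length] at hi
  refine ⟨w.letters[i - 1]'(by omega), ?_⟩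
  rw [List.mk_mem_zipIdx_iff_le_and_getElem?_sub]
  exact ⟨hi.1, List.getElem?_eq_getElem _⟩

/-- Replaces the filtered list in `restrict` by the sorted position set, on which all later
arguments work; `some` appears because `letterAt` is partial. -/
theorem map_some_letters_restrict (hS : S ⊆ Finset.Icc 1 w.length) :
    (w.restrict S).letters.map some = S.sort.map w.letterAt := by
  set L := (w.letters.zipIdx 1).filter (fun p => p.2 ∈ S) with hL
  have hsorted : (L.map Prod.snd).SortedLT := by
    rw [List.sortedLT_iff_pairwise]
    refine List.Pairwise.sublist (List.Sublist.map _ List.filter_sublist) ?_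
    rw [List.zipIdx_map_snd, List.pairwise_iff_getElem]
    intro i j hi hj hij
    simpa using hij
  have hset : (L.map Prod.snd).toFinset = S := by
    ext i
    simp only [List.mem_toFinset, List.mem_map, hL, List.mem_filter, decide_eq_true_eq]
    constructor
    · rintro ⟨p, ⟨_, h⟩, rfl⟩
      exact h
    · intro hi
      obtain ⟨c, hc⟩ := exists_mem_zipIdx (hS hi)
      exact ⟨_, ⟨hc, hi⟩, rfl⟩
  have hsort := hsorted.sort_toFinset
  rw [hset] at hsort
  rw [hsort]
  simp only [restrict, List.map_map, ← hL]
  refine List.map_congr_left fun p hp => ?_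
  exact (letterAt_mem_zipIdx (List.mem_filter.1 hp).1).1.symm

theorem restrict_eq_iff (hS : S ⊆ Finset.Icc 1 w.length) :
    w.restrict S = x ↔ x.letters.map some = S.sort.map w.letterAt := by
  rw [← map_some_letters_restrict hS, (Option.some_injective Letter).list_map.eq_iff, Word.ext_iff,
    eq_comm]

theorem length_restrict (hS : S ⊆ Finset.Icc 1 w.length) : (w.restrict S).length = S.card := by
  have := congrArg List.length (map_some_letters_restrict hS)
  simpa [length] using this

theorem restrict_full (w : Word) : w.restrict (Finset.Icc 1 w.length) = w := by
  ext1
  simp only [restrict]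
  rw [List.filter_eq_self.2, List.zipIdx_map_fst]
  intro p hp
  simpa using letterAt_mem_zipIdx hp |>.2

theorem restrict_mono (w : Word) (h : T ⊆ S) : w.restrict T ≤ w.restrict S := by
  change List.Sublist _ _
  simp only [restrict]
  refine List.Sublist.map _ ?_
  refine List.monotone_filter_right _ fun p hp => ?_
  simp only [decide_eq_true_eq] at hp ⊢
  exact h hp

theorem exists_restrict_eq_of_le (hS : S ⊆ Finset.Icc 1 w.length) (h : x ≤ w.restrict S) :
    ∃ T ⊆ S, w.restrict T = x := by
  have h1 : (x.letters.map some).Sublist (S.sort.map w.letterAt) := by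
    rw [← map_some_letters_restrict hS]
    exact List.Sublist.map _ h
  obtain ⟨l, hl, he⟩ := List.sublist_map_iff.1 h1
  have hlt : l.SortedLT := ((Finset.sortedLT_sort S).pairwise.sublist hl).sortedLT
  have hT : l.toFinset ⊆ S := fun i hi => by
    simpa using hl.subset (List.mem_toFinset.1 hi)
  refine ⟨l.toFinset, hT, ?_⟩
  rw [restrict_eq_iff (hT.trans hS), hlt.sort_toFinset, he]

/-- The letter of `w` at `t ∈ T` is the letter of `w.restrict T` at the rank of `t` in `T`. -/
theorem letterAt_restrict (hT : T ⊆ Finset.Icc 1 w.length) {t : ℕ} (ht : t ∈ T) :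
    (w.restrict T).letterAt (T.filter (· ≤ t)).card = w.letterAt t := by
  have hsplit : T = (T.filter (· < t) ∪ {t}) ∪ T.filter (t < ·) := by
    ext i
    simp only [Finset.mem_union, Finset.mem_filter, Finset.mem_singleton]
    grind
  have hcard : (T.filter (· ≤ t)).card = (T.filter (· < t)).card + 1 := by
    rw [← Finset.card_insert_of_notMem (a := t) (by simp)]
    congr 1
    ext i
    simp only [Finset.mem_insert, Finset.mem_filter]
    grind
  have hsort : T.sort = (T.filter (· < t)).sort ++ [t] ++ (T.filter (t < ·)).sort := by
    conv_lhs => rw [hsplit]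
    rw [Finset.sort_union_of_lt, Finset.sort_union_of_lt, Finset.sort_singleton]
    · simp
    · intro i hi j hj
      simp only [Finset.mem_union, Finset.mem_filter, Finset.mem_singleton] at hi hj
      omega
  have h1 := map_some_letters_restrict hT
  have h2 := congrArg (fun l => l[(T.filter (· < t)).card]?) h1
  rw [hcard]
  simp only [List.getElem?_map, hsort] at h2
  rw [List.append_assoc, List.getElem?_append_right (by simp)] at h2
  simp only [Finset.length_sort, Nat.sub_self, List.cons_append, List.getElem?_cons_zero,
    Option.map_some] at h2
  change (w.restrict T).letters[(T.filter (· < t)).card]? = _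
  cases h : (w.restrict T).letters[(T.filter (· < t)).card]? with
  | none => simp [h] at h2
  | some c => simpa [h] using h2

theorem restrict_append {A B : Finset ℕ} (h : ∀ i ∈ A, ∀ j ∈ B, i < j)
    (hA : A ⊆ Finset.Icc 1 w.length) (hB : B ⊆ Finset.Icc 1 w.length) :
    (w.restrict (A ∪ B)).letters = (w.restrict A).letters ++ (w.restrict B).letters := by
  apply (Option.some_injective Letter).list_map
  rw [map_some_letters_restrict (Finset.union_subset hA hB), List.map_append,
    map_some_letters_restrict hA, map_some_letters_restrict hB, Finset.sort_union_of_lt h,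
    List.map_append]

/-- Moving a position to an adjacent one with the same letter does not change the subword. -/
theorem restrict_swap (hT : T ⊆ Finset.Icc 1 w.length) {t i : ℕ} (ht : t ∈ T)
    (hi : i ∈ Finset.Icc 1 w.length) (hti : t < i)
    (hgap : ∀ k ∈ T, t < k → i < k) (hw : w.letterAt t = w.letterAt i) :
    w.restrict (insert i (T.erase t)) = w.restrict T := by
  have hsub : insert i (T.erase t) ⊆ Finset.Icc 1 w.length :=
    Finset.insert_subset hi ((Finset.erase_subset _ _).trans hT)
  rw [restrict_eq_iff hsub, map_some_letters_restrict hT]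
  have h1 : T = (T.filter (· < t) ∪ {t}) ∪ T.filter (t < ·) := by
    ext k
    simp only [Finset.mem_union, Finset.mem_filter, Finset.mem_singleton]
    grind
  have h2 : insert i (T.erase t) = (T.filter (· < t) ∪ {i}) ∪ T.filter (t < ·) := by
    ext k
    simp only [Finset.mem_union, Finset.mem_filter, Finset.mem_singleton, Finset.mem_insert,
      Finset.mem_erase]
    grind
  rw [h2]
  conv_lhs => rw [h1]
  rw [Finset.sort_union_of_lt, Finset.sort_union_of_lt, Finset.sort_union_of_lt,
    Finset.sort_union_of_lt]
  · simp [hw]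
  all_goals
    intro k hk j hj
    simp only [Finset.mem_union, Finset.mem_filter, Finset.mem_singleton] at hk hj
    grind

/-- A subword has no `d + 1` consecutive letters `b` if and only if every interval of positions
that meets it only in letters `b` meets it in at most `d` letters. -/
theorem runsLE_restrict_iff {d : ℕ} (hS : S ⊆ Finset.Icc 1 w.length) :
    RunsLE d (w.restrict S) ↔ ∀ l h, (∀ i ∈ S, l ≤ i → i ≤ h → w.letterAt i = some Letter.b) →
      (S ∩ Finset.Icc l h).card ≤ d := by
  constructor
  · intro hd l h hb
    by_contra! hc
    apply hd
    have hle : l ≤ h := by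
      by_contra! hlt
      simp [Finset.Icc_eq_empty_of_lt hlt] at hc
    have hsplit : S = (S.filter (· < l) ∪ S ∩ Finset.Icc l h) ∪ S.filter (h < ·) := by
      ext k
      simp only [Finset.mem_union, Finset.mem_filter, Finset.mem_inter, Finset.mem_Icc]
      grind
    have hM : S ∩ Finset.Icc l h ⊆ Finset.Icc 1 w.length := Finset.inter_subset_left.trans hS
    have h1 : S.filter (· < l) ⊆ Finset.Icc 1 w.length := (Finset.filter_subset _ _).trans hS
    have h2 : S.filter (h < ·) ⊆ Finset.Icc 1 w.length := (Finset.filter_subset _ _).trans hS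
    have hmid : (w.restrict (S ∩ Finset.Icc l h)).letters =
        List.replicate (S ∩ Finset.Icc l h).card Letter.b := by
      apply (Option.some_injective Letter).list_map
      rw [map_some_letters_restrict hM, List.map_replicate, List.eq_replicate_iff]
      refine ⟨by simp, ?_⟩
      intro c hc
      obtain ⟨i, hi, rfl⟩ := List.mem_map.1 hc
      simp only [Finset.mem_sort, Finset.mem_inter, Finset.mem_Icc] at hi
      exact hb i hi.1 hi.2.1 hi.2.2
    rw [hsplit, restrict_append _ (Finset.union_subset h1 hM) h2, restrict_append _ h1 hM, hmid]
    · refine List.IsInfix.trans ?_ (List.infix_append _ _ _)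
      obtain ⟨k, hk⟩ := Nat.exists_eq_add_of_le hc
      rw [hk, List.replicate_add (d + 1)]
      exact (List.prefix_append _ _).isInfix
    · simp only [Finset.mem_filter, Finset.mem_inter, Finset.mem_Icc]
      omega
    · simp only [Finset.mem_union, Finset.mem_filter, Finset.mem_inter, Finset.mem_Icc]
      omega
  · intro h hinf
    -- Pull the factor of `d + 1` letters `b` back to a block `M` of the sorted positions; the
    -- interval spanned by `M` violates the bound.
    obtain ⟨P, Q, hPQ⟩ := hinf
    have h1 := map_some_letters_restrict hS
    rw [← hPQ, List.map_append, List.map_append, eq_comm] at h1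
    obtain ⟨AM, B, hAMB, hAM, hB⟩ := List.map_eq_append_iff.1 h1
    obtain ⟨A, M, rfl, hA, hM⟩ := List.map_eq_append_iff.1 hAM
    have hlen : M.length = d + 1 := by simpa using congrArg List.length hM
    have hMb : ∀ i ∈ M, w.letterAt i = some Letter.b := by
      intro i hi
      have := List.mem_map_of_mem (f := w.letterAt) hi
      rw [hM] at this
      simpa using this
    have hsorted := (Finset.sortedLT_sort S).pairwise
    have hmem : ∀ i, i ∈ S ↔ (i ∈ A ∨ i ∈ M) ∨ i ∈ B := by
      intro i
      rw [← Finset.mem_sort (r := (· ≤ ·)) (s := S), hAMB]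
      simp [or_assoc]
    rw [hAMB, List.pairwise_append, List.pairwise_append] at hsorted
    obtain ⟨⟨hA1, hM1, hAM1⟩, hB1, hAMB1⟩ := hsorted
    have hne : M ≠ [] := by
      rintro rfl
      simp at hlen
    have hlast : ∀ i ∈ M, i ≤ M.getLast hne := fun i hi =>
      hM1.sortedLT.sortedLE.pairwise.rel_getLast hi
    have hhead : ∀ i ∈ M, M.head hne ≤ i := fun i hi =>
      hM1.sortedLT.sortedLE.pairwise.rel_head hi
    have hbd : ∀ i ∈ S, M.head hne ≤ i → i ≤ M.getLast hne → i ∈ M := by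
      intro i hi h1 h2
      rcases (hmem i).1 hi with (hi | hi) | hi
      · have := hAM1 i hi _ (List.head_mem hne)
        omega
      · exact hi
      · have := hAMB1 (M.getLast hne) (by simp) i hi
        omega
    have := h (M.head hne) (M.getLast hne) fun i hi h1 h2 => hMb i (hbd i hi h1 h2)
    have hsub : M.toFinset ⊆ S ∩ Finset.Icc (M.head hne) (M.getLast hne) := by
      intro i hi
      rw [List.mem_toFinset] at hi
      simp only [Finset.mem_inter, Finset.mem_Icc]
      exact ⟨(hmem i).2 (Or.inl (Or.inr hi)), hhead i hi, hlast i hi⟩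
    have h3 := Finset.card_le_card hsub
    rw [List.toFinset_card_of_nodup hM1.sortedLT.nodup] at h3
    omega

end Word

/-! ### Deletion sequences -/

namespace Finset

theorem exists_card_filter_le_eq (s : Finset ℕ) {j : ℕ} (h1 : 1 ≤ j) (h2 : j ≤ s.card) :
    ∃ p ∈ s, (s.filter (· ≤ p)).card = j := by
  induction s using Finset.induction_on_max with
  | empty => simp at h2; omega
  | insert a s ha ih =>
    have has : a ∉ s := fun h => lt_irrefl _ (ha a h)
    rw [card_insert_of_notMem has] at h2
    rcases Nat.lt_or_ge s.card j with hj | hj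
    · refine ⟨a, mem_insert_self _ _, ?_⟩
      rw [filter_true_of_mem, card_insert_of_notMem has]
      · omega
      · intro x hx
        rcases mem_insert.1 hx with rfl | hx
        · exact le_rfl
        · exact (ha x hx).le
    · obtain ⟨p, hp, hpj⟩ := ih hj
      refine ⟨p, mem_insert_of_mem hp, ?_⟩
      rw [filter_insert, if_neg (not_le.2 (ha p hp)), hpj]

/-- The counting function of a set jumps exactly at its elements. -/
theorem eq_of_card_filter_le_eq {s t : Finset ℕ}
    (h : ∀ m, (s.filter (· ≤ m)).card = (t.filter (· ≤ m)).card) : s = t := by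
  have key : ∀ (u : Finset ℕ) (m : ℕ),
      m ∈ u ↔ (u.filter (· < m)).card < (u.filter (· ≤ m)).card := by
    intro u m
    constructor
    · intro hm
      apply card_lt_card
      refine ⟨fun x hx => ?_, fun hsub => ?_⟩
      · simp only [mem_filter] at hx ⊢
        exact ⟨hx.1, hx.2.le⟩
      · have := hsub (mem_filter.2 ⟨hm, le_rfl⟩)
        simp at this
    · intro hlt
      by_contra hm
      refine hlt.ne (congrArg card (filter_congr fun x hx => ?_))
      have : x ≠ m := fun h => hm (h ▸ hx)
      omega
  have hlt : ∀ m, (s.filter (· < m)).card = (t.filter (· < m)).card := by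
    intro m
    cases m with
    | zero => simp
    | succ k => simpa only [Nat.lt_succ_iff] using h k
  ext m
  rw [key, key, h, hlt]

end Finset

/-! ### Run heads, rightmost embeddings and deletion sequences -/

namespace Word

variable {d : ℕ} {w x : Word} {S T : Finset ℕ}

/-- `i ∈ S` is the first letter of a run of the subword of `w` at the positions `S`. -/
def IsRunHead (w : Word) (S : Finset ℕ) (i : ℕ) : Prop :=
  i ∈ S ∧ ∀ j ∈ S, j < i → (∀ k ∈ S, k < i → k ≤ j) → w.letterAt j ≠ w.letterAt i

/-- `T` is a rightmost embedding among those contained in `S`: no letter can be moved to the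
right inside its gap. -/
def IsRightmost (w : Word) (S T : Finset ℕ) : Prop :=
  ∀ i ∈ S, i ∉ T → ∀ t ∈ T, t < i → (∀ k ∈ T, k < i → k ≤ t) → w.letterAt t ≠ w.letterAt i

/-- Choose an embedding with the largest sum of positions: moving a letter to the right would
increase the sum. -/
theorem exists_isRightmost (hS : S ⊆ Finset.Icc 1 w.length) (h : x ≤ w.restrict S) :
    ∃ T ⊆ S, w.restrict T = x ∧ IsRightmost w S T := by
  obtain ⟨T₀, hT₀, hx₀⟩ := exists_restrict_eq_of_le hS h
  obtain ⟨T, hT, hmax⟩ := Finset.exists_max_image (S.powerset.filter fun T => w.restrict T = x)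
    (fun T => ∑ i ∈ T, i) ⟨T₀, by simp [hT₀, hx₀]⟩
  simp only [Finset.mem_filter, Finset.mem_powerset, and_imp] at hT hmax
  refine ⟨T, hT.1, hT.2, fun i hi hiT t ht hti hpred heq => ?_⟩
  have hsub : insert i (T.erase t) ⊆ S :=
    Finset.insert_subset hi ((Finset.erase_subset _ _).trans hT.1)
  have hr : w.restrict (insert i (T.erase t)) = x := by
    rw [restrict_swap (hT.1.trans hS) ht (hS hi) hti _ heq, hT.2]
    intro k hk htk
    by_contra hki
    have : k ≠ i := fun h => hiT (h ▸ hk)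
    have := hpred k hk (by omega)
    omega
  have := hmax _ hsub hr
  rw [Finset.sum_insert (fun h => hiT (Finset.mem_of_mem_erase h)),
    ← Finset.add_sum_erase _ _ ht] at this
  omega

/-- A rightmost embedding lies to the right of every other embedding of the same word. -/
theorem IsRightmost.card_filter_le (hS : S ⊆ Finset.Icc 1 w.length) (hT : T ⊆ S)
    (h : IsRightmost w S T) {T' : Finset ℕ} (hT' : T' ⊆ S) (heq : w.restrict T' = w.restrict T)
    (m : ℕ) : (T.filter (· ≤ m)).card ≤ (T'.filter (· ≤ m)).card := by
  have hcard : T'.card = T.card := by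
    rw [← length_restrict (hT.trans hS), ← length_restrict (hT'.trans hS), heq]
  have hmono : ∀ (U : Finset ℕ) {k l : ℕ}, k ≤ l →
      (U.filter (· ≤ k)).card ≤ (U.filter (· ≤ l)).card := fun U k l hkl =>
    Finset.card_le_card (Finset.monotone_filter_right _ fun i _ hi => le_trans hi hkl)
  by_contra! hbad
  set B := T.filter fun m => (T'.filter (· ≤ m)).card < (T.filter (· ≤ m)).card with hB
  have hBne : B.Nonempty := by
    have hne : (T.filter (· ≤ m)).Nonempty := Finset.card_pos.1 (by omega)
    have hmem := Finset.mem_filter.1 (Finset.max'_mem _ hne)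
    refine ⟨_, Finset.mem_filter.2 ⟨hmem.1, ?_⟩⟩
    refine (hmono T' hmem.2).trans_lt (hbad.trans_le (Finset.card_le_card fun i hi => ?_))
    exact Finset.mem_filter.2 ⟨(Finset.mem_filter.1 hi).1, Finset.le_max' _ _ hi⟩
  -- At the last position `q` where `T` is ahead, `T'` places the letter of the same rank at some `p
  -- > q`. By maximality `T` has nothing in `(q, p]`, so `q` could be moved to `p`.
  obtain ⟨q, hq⟩ : ∃ q, q = B.max' hBne := ⟨_, rfl⟩
  have hqB : q ∈ B := hq ▸ Finset.max'_mem B hBne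
  have hqmax : ∀ k ∈ B, k ≤ q := fun k hk => hq ▸ Finset.le_max' B k hk
  obtain ⟨hqT, hqlt⟩ := Finset.mem_filter.1 hqB
  have hrank : (T.filter (· ≤ q)).card ≤ T'.card :=
    hcard ▸ Finset.card_le_card (Finset.filter_subset _ _)
  obtain ⟨p, hpT', hp⟩ := Finset.exists_card_filter_le_eq T' (by omega) hrank
  have hqp : q < p := by
    by_contra! hle
    have := hmono T' hle
    omega
  have hletter : w.letterAt q = w.letterAt p := by
    rw [← letterAt_restrict (hT.trans hS) hqT, ← letterAt_restrict (hT'.trans hS) hpT', heq, hp]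
  have hgap : ∀ k ∈ T, k ≤ p → k ≤ q := by
    intro k hk hkp
    by_contra! hqk
    have h1 : (T.filter (· ≤ q)).card < (T.filter (· ≤ k)).card := by
      apply Finset.card_lt_card
      refine ⟨Finset.monotone_filter_right _ fun i _ hi => le_trans hi hqk.le, fun hsub => ?_⟩
      have := hsub (Finset.mem_filter.2 ⟨hk, le_rfl⟩)
      simp only [Finset.mem_filter] at this
      omega
    have h2 := hmono T' hkp
    have := hqmax k (Finset.mem_filter.2 ⟨hk, by omega⟩)
    omega
  refine h p (hT' hpT') (fun hpT => ?_) q hqT hqp (fun k hk hkp => hgap k hk hkp.le) hletter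
  have := hgap p hpT le_rfl
  omega

theorem IsRightmost.unique (hS : S ⊆ Finset.Icc 1 w.length) (hT : T ⊆ S)
    (h : IsRightmost w S T) {T' : Finset ℕ} (hT' : T' ⊆ S) (h' : IsRightmost w S T')
    (heq : w.restrict T' = w.restrict T) : T' = T :=
  Finset.eq_of_card_filter_le_eq fun m =>
    (h'.card_filter_le hS hT' hT heq.symm m).antisymm (h.card_filter_le hS hT hT' heq m)

/-- Take an interval that is all `b` after `i` is erased. If it contains `i` and an element of `S`
left of `i`, all its remaining elements lie in `T`: otherwise a letter `b` of `T` could move right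
to a missing one. Then the bound for `T` applies. If it contains `i` but nothing of `S` before it,
the rest is a run of `S`; if it avoids `i`, nothing has changed. -/
theorem IsRightmost.runsLE_erase (hS : S ⊆ Finset.Icc 1 w.length) (hT : T ⊆ S)
    (h : IsRightmost w S T) (hdS : RunsLE d (w.restrict S)) (hdT : RunsLE d (w.restrict T))
    {i : ℕ} (hiT : i ∉ T) (hmin : ∀ j ∈ S, j < i → j ∈ T) :
    RunsLE d (w.restrict (S.erase i)) := by
  rw [runsLE_restrict_iff hS] at hdS
  rw [runsLE_restrict_iff (hT.trans hS)] at hdT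
  rw [runsLE_restrict_iff ((Finset.erase_subset _ _).trans hS)]
  intro l r hb
  by_cases hil : ∃ j ∈ S, l ≤ j ∧ j < i ∧ i ≤ r
  · obtain ⟨j, hjS, hlj, hji, hir⟩ := hil
    have hjT := hmin j hjS hji
    have hsub : S.erase i ∩ Finset.Icc l r ⊆ T ∩ Finset.Icc l r := by
      intro k hk
      simp only [Finset.mem_inter, Finset.mem_erase, Finset.mem_Icc] at hk ⊢
      refine ⟨?_, hk.2⟩
      by_contra hkT
      have hik : i < k := by
        by_contra! hki
        exact hkT (hmin k hk.1.2 (by omega))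
      have hne : (T.filter (· < k)).Nonempty := ⟨j, Finset.mem_filter.2 ⟨hjT, by omega⟩⟩
      have hmem := Finset.mem_filter.1 (Finset.max'_mem _ hne)
      have hge : j ≤ (T.filter (· < k)).max' hne :=
        Finset.le_max' _ _ (Finset.mem_filter.2 ⟨hjT, by omega⟩)
      refine h k hk.1.2 hkT _ hmem.1 hmem.2
        (fun q hq hqk => Finset.le_max' _ _ (Finset.mem_filter.2 ⟨hq, hqk⟩)) ?_
      rw [hb k (Finset.mem_erase.2 hk.1) hk.2.1 hk.2.2]
      refine hb _ (Finset.mem_erase.2 ⟨fun hm => hiT (hm ▸ hmem.1), hT hmem.1⟩) (by omega) (by omega)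
    refine (Finset.card_le_card hsub).trans (hdT l r fun k hk h1 h2 => ?_)
    exact hb k (Finset.mem_erase.2 ⟨fun hm => hiT (hm ▸ hk), hT hk⟩) h1 h2
  · push Not at hil
    by_cases hi : l ≤ i ∧ i ≤ r
    · have hsub : S.erase i ∩ Finset.Icc l r ⊆ S ∩ Finset.Icc (i + 1) r := by
        intro k hk
        simp only [Finset.mem_inter, Finset.mem_erase, Finset.mem_Icc] at hk ⊢
        refine ⟨hk.1.2, ?_, hk.2.2⟩
        by_contra hki
        have := hil k hk.1.2 hk.2.1 (by omega)
        omega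
      refine (Finset.card_le_card hsub).trans (hdS _ r fun k hk h1 h2 => ?_)
      exact hb k (Finset.mem_erase.2 ⟨by omega, hk⟩) (by omega) h2
    · refine (Finset.card_le_card (Finset.inter_subset_inter_right (Finset.erase_subset i S))).trans
        (hdS l r fun k hk h1 h2 => hb k (Finset.mem_erase.2 ⟨fun hki => hi ?_, hk⟩) h1 h2)
      exact hki ▸ ⟨h1, h2⟩

/-- `l` lists positions that can be deleted one after the other from the subword of `w` at the
positions `S`, each being the head of a run when it is deleted, so that all words
obtained on the way lie in `A*_d`. -/
def IsDeletion (d : ℕ) (w : Word) : Finset ℕ → List ℕ → Prop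
  | _, [] => True
  | S, i :: l => IsRunHead w S i ∧ RunsLE d (w.restrict (S.erase i)) ∧ IsDeletion d w (S.erase i) l

theorem sdiff_toFinset_cons (S : Finset ℕ) (i : ℕ) (l : List ℕ) :
    S \ (i :: l).toFinset = S.erase i \ l.toFinset := by
  rw [List.toFinset_cons, Finset.sdiff_insert, Finset.erase_sdiff_comm]

theorem IsDeletion.subset_and_nodup {l : List ℕ} (h : IsDeletion d w S l) :
    l.toFinset ⊆ S ∧ l.Nodup := by
  induction l generalizing S with
  | nil => simp
  | cons i l ih =>
    obtain ⟨h1, h2⟩ := ih h.2.2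
    refine ⟨?_, ?_⟩
    · rw [List.toFinset_cons]
      exact Finset.insert_subset h.1.1 (h1.trans (Finset.erase_subset _ _))
    · refine List.nodup_cons.2 ⟨fun hi => ?_, h2⟩
      simpa using h1 (List.mem_toFinset.2 hi)

/-- When `i` is deleted, later deletions are to its right. So the predecessor of `i` in the final
set is its predecessor at that moment, which carries the other letter. -/
theorem IsDeletion.isRightmost {l : List ℕ} (h : IsDeletion d w S l) (hl : l.Pairwise (· ≤ ·)) :
    IsRightmost w S (S \ l.toFinset) := by
  induction l generalizing S with
  | nil => intro i hi hiT; simp [hi] at hiT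
  | cons i l ih =>
    rw [List.pairwise_cons] at hl
    have hi := h.1
    have hr := ih h.2.2 hl.2
    rw [sdiff_toFinset_cons]
    intro j hj hjT t ht htj hpred
    by_cases hji : j = i
    · subst hji
      refine hi.2 t (Finset.mem_of_mem_erase (Finset.mem_sdiff.1 ht).1) htj fun k hk hkj => ?_
      refine hpred k (Finset.mem_sdiff.2 ⟨Finset.mem_erase.2 ⟨hkj.ne, hk⟩, fun hkl => ?_⟩) hkj
      have := hl.1 k (List.mem_toFinset.1 hkl)
      omega
    · exact hr j (Finset.mem_erase.2 ⟨hji, hj⟩) hjT t ht htj hpred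

/-- A rightmost embedding is reached by a unique increasing deletion sequence, which is
lexicographically smaller than all other deletion sequences that lead to the same word. -/
theorem IsRightmost.exists_isDeletion (hS : S ⊆ Finset.Icc 1 w.length) (hT : T ⊆ S)
    (h : IsRightmost w S T) (hdS : RunsLE d (w.restrict S)) (hdT : RunsLE d (w.restrict T)) :
    ∃ l, IsDeletion d w S l ∧ S \ l.toFinset = T ∧ l.Pairwise (· ≤ ·) ∧
      ∀ l', IsDeletion d w S l' → w.restrict (S \ l'.toFinset) = w.restrict T → l' ≠ l →
        ¬ l'.Pairwise (· ≤ ·) ∧ List.Lex (· < ·) l l' := by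
  induction hn : (S \ T).card generalizing S with
  | zero =>
    have hST : S = T := by
      rw [Finset.card_eq_zero, Finset.sdiff_eq_empty_iff_subset] at hn
      exact hn.antisymm hT
    subst hST
    refine ⟨[], trivial, by simp, by simp, fun l' hl' heq hne => absurd ?_ hne⟩
    have hc := congrArg length heq
    have hsub := hl'.subset_and_nodup.1
    rw [length_restrict (Finset.sdiff_subset.trans hS), length_restrict hS,
      Finset.card_sdiff_of_subset hsub] at hc
    have := Finset.card_le_card hsub
    have h0 : l'.toFinset.card = 0 := by omega
    simpa using h0
  | succ n ih =>
    have hne : (S \ T).Nonempty := Finset.card_pos.1 (by omega)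
    -- An increasing sequence has to delete the least superfluous position first.
    obtain ⟨i, hi⟩ : ∃ i, i = (S \ T).min' hne := ⟨_, rfl⟩
    obtain ⟨hiS, hiT⟩ := Finset.mem_sdiff.1 (hi ▸ Finset.min'_mem _ hne)
    have hmin : ∀ j ∈ S, j < i → j ∈ T := by
      intro j hj hji
      by_contra hjT
      have := hi ▸ Finset.min'_le (S \ T) j (Finset.mem_sdiff.2 ⟨hj, hjT⟩)
      omega
    have hd := h.runsLE_erase hS hT hdS hdT hiT hmin
    have hSi : S.erase i ⊆ Finset.Icc 1 w.length := (Finset.erase_subset _ _).trans hS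
    have hTi : T ⊆ S.erase i := fun t ht => Finset.mem_erase.2 ⟨fun e => hiT (e ▸ ht), hT ht⟩
    obtain ⟨l, hl, hlT, hlp, hlex⟩ := ih hSi hTi
      (fun j hj => h j (Finset.mem_of_mem_erase hj)) hd (by
        rw [Finset.erase_sdiff_comm, Finset.card_erase_of_mem (Finset.mem_sdiff.2 ⟨hiS, hiT⟩)]
        omega)
    have hhead : IsRunHead w S i := by
      refine ⟨hiS, fun j hj hji hpred => h i hiS hiT j (hmin j hj hji) hji fun k hk hki => ?_⟩
      exact hpred k (hT hk) hki
    refine ⟨i :: l, ⟨hhead, hd, hl⟩, by rw [sdiff_toFinset_cons, hlT], ?_, ?_⟩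
    · refine List.pairwise_cons.2 ⟨fun j hj => ?_, hlp⟩
      have hjS := hl.subset_and_nodup.1 (List.mem_toFinset.2 hj)
      by_contra! hji
      have hjT := hmin j (Finset.mem_of_mem_erase hjS) hji
      rw [← hlT] at hjT
      exact (Finset.mem_sdiff.1 hjT).2 (List.mem_toFinset.2 hj)
    · intro l' hl' heq hne'
      have hsub' : S \ l'.toFinset ⊆ S := Finset.sdiff_subset
      cases l' with
      | nil =>
        exfalso
        have hc := congrArg length heq
        rw [List.toFinset_nil, Finset.sdiff_empty, length_restrict hS,
          length_restrict (hT.trans hS)] at hc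
        exact hiT (Finset.eq_of_subset_of_card_le hT hc.le ▸ hiS)
      | cons i' l₁ =>
        have hi'S := hl'.1.1
        rcases lt_trichotomy i i' with hlt | rfl | hgt
        · refine ⟨fun hp => ?_, List.Lex.rel hlt⟩
          -- An increasing competitor would also end in `T`, hence would have to delete `i` after
          -- the larger `i'`.
          have hTT := h.unique hS hT hsub' (hl'.isRightmost hp) heq
          have hil : i ∈ (i' :: l₁).toFinset := by
            by_contra hil
            exact hiT (hTT ▸ Finset.mem_sdiff.2 ⟨hiS, hil⟩)
          rcases List.mem_cons.1 (List.mem_toFinset.1 hil) with hii | hil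
          · omega
          · have := (List.pairwise_cons.1 hp).1 i hil
            omega
        · rw [sdiff_toFinset_cons] at heq
          obtain ⟨h1, h2⟩ := hlex l₁ hl'.2.2 heq (fun e => hne' (e ▸ rfl))
          exact ⟨fun hp => h1 (List.pairwise_cons.1 hp).2, List.Lex.cons h2⟩
        · exfalso
          -- For `i' < i`, `T` contains all of `S` up to `i'`, while the competitor lacks `i'`; but
          -- `T` has the fewest positions up to any point.
          have hle := h.card_filter_le hS hT hsub' heq i'
          refine absurd hle (not_le.2 (Finset.card_lt_card ⟨fun k hk => ?_, fun hsub => ?_⟩))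
          · simp only [Finset.mem_filter] at hk ⊢
            exact ⟨hmin k (hsub' hk.1) (by omega), hk.2⟩
          · have := hsub (Finset.mem_filter.2 ⟨hmin i' hi'S hgt, le_rfl⟩)
            simp at this

end Word

/-! ### Björner's labeling is a dual CL-labeling -/

namespace Word

variable {d : ℕ} {w x : Word} {S T : Finset ℕ} {i : ℕ}

theorem length_lt_of_lt {u v : Word} (h : u < v) : u.length < v.length := by
  refine lt_of_le_of_ne (List.Sublist.length_le h.le) fun he => h.ne ?_
  exact Word.ext (List.Sublist.eq_of_length h.le he)

theorem covBy_of_length {u v : Word} (h : u ≤ v) (hl : u.length + 1 = v.length) : u ⋖ v := by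
  refine ⟨lt_of_le_of_ne h fun e => ?_, fun z h1 h2 => ?_⟩
  · subst e
    omega
  · have := length_lt_of_lt h1
    have := length_lt_of_lt h2
    omega

/-- The predecessor of `i` in `S` carries the same letter and can be deleted in its place. -/
theorem restrict_erase_eq_of_not_isRunHead (hS : S ⊆ Finset.Icc 1 w.length) (hi : i ∈ S)
    (h : ¬ IsRunHead w S i) : ∃ j ∈ S, j < i ∧ w.restrict (S.erase j) = w.restrict (S.erase i) := by
  simp only [IsRunHead, hi, true_and] at h
  push Not at h
  obtain ⟨j, hj, hji, hpred, hw⟩ := h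
  refine ⟨j, hj, hji, ?_⟩
  have := restrict_swap (T := S.erase i) ((Finset.erase_subset _ _).trans hS)
    (Finset.mem_erase.2 ⟨hji.ne, hj⟩) (hS hi) hji (fun k hk hjk => ?_) hw
  · rw [← this]
    congr 1
    ext k
    simp only [Finset.mem_erase, Finset.mem_insert]
    grind
  · obtain ⟨hki, hk⟩ := Finset.mem_erase.1 hk
    by_contra hle
    have := hpred k hk (by omega)
    omega

/-- Compare the letters whose rank is the number of elements of `S` before `i`: after erasing `i` it
is the predecessor of `i`, after erasing `j` it is `i` itself, and these letters differ. -/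
theorem IsRunHead.restrict_erase_ne (hS : S ⊆ Finset.Icc 1 w.length) (h : IsRunHead w S i) {j : ℕ}
    (hj : j ∈ S) (hji : j < i) : w.restrict (S.erase j) ≠ w.restrict (S.erase i) := by
  intro heq
  have hne : (S.filter (· < i)).Nonempty := ⟨j, Finset.mem_filter.2 ⟨hj, hji⟩⟩
  obtain ⟨p, hp⟩ : ∃ p, p = (S.filter (· < i)).max' hne := ⟨_, rfl⟩
  obtain ⟨hpS, hpi⟩ := Finset.mem_filter.1 (hp ▸ Finset.max'_mem _ hne)
  have hpmax : ∀ k ∈ S, k < i → k ≤ p := fun k hk hki =>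
    hp ▸ Finset.le_max' _ _ (Finset.mem_filter.2 ⟨hk, hki⟩)
  refine h.2 p hpS hpi hpmax ?_
  rw [← letterAt_restrict (T := S.erase i) ((Finset.erase_subset _ _).trans hS)
      (Finset.mem_erase.2 ⟨hpi.ne, hpS⟩),
    ← letterAt_restrict (T := S.erase j) ((Finset.erase_subset _ _).trans hS)
      (Finset.mem_erase.2 ⟨hji.ne', h.1⟩), heq]
  congr 1
  have h1 : (S.erase i).filter (· ≤ p) = S.filter (· < i) := by
    ext k
    simp only [Finset.mem_filter, Finset.mem_erase]
    have := hpmax k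
    grind
  have h2 : insert i ((S.filter (· < i)).erase j) = (S.erase j).filter (· ≤ i) := by
    ext k
    have := h.1
    simp only [Finset.mem_filter, Finset.mem_erase, Finset.mem_insert]
    grind
  have hmem : j ∈ S.filter (· < i) := Finset.mem_filter.2 ⟨hj, hji⟩
  have := Finset.card_pos.2 hne
  rw [h1, ← h2, Finset.card_insert_of_notMem (by simp), Finset.card_erase_of_mem hmem]
  omega

theorem IsRunHead.sInf_eq (hS : S ⊆ Finset.Icc 1 w.length) (h : IsRunHead w S i) :
    sInf {j : ℕ | j ∈ S ∧ IsEmbedding (w.restrict (S.erase i)) w (S.erase j)} = i := by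
  have hmem : i ∈ {j : ℕ | j ∈ S ∧ IsEmbedding (w.restrict (S.erase i)) w (S.erase j)} :=
    ⟨h.1, (Finset.erase_subset _ _).trans hS, rfl⟩
  refine (Nat.sInf_le hmem).antisymm (le_of_not_gt fun hlt => ?_)
  have := Nat.sInf_mem ⟨i, hmem⟩
  exact h.restrict_erase_ne hS this.1 hlt this.2.2

theorem isRunHead_sInf (hS : S ⊆ Finset.Icc 1 w.length) (hx : x ≤ w.restrict S)
    (hl : x.length + 1 = (w.restrict S).length) :
    IsRunHead w S (sInf {j : ℕ | j ∈ S ∧ IsEmbedding x w (S.erase j)}) ∧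
      w.restrict (S.erase (sInf {j : ℕ | j ∈ S ∧ IsEmbedding x w (S.erase j)})) = x := by
  obtain ⟨T, hT, rfl⟩ := exists_restrict_eq_of_le hS hx
  rw [length_restrict hS, length_restrict (hT.trans hS)] at hl
  obtain ⟨i, hi, rfl⟩ : ∃ i ∈ S, T = S.erase i := by
    have h1 : (S \ T).card = 1 := by
      rw [Finset.card_sdiff_of_subset hT]
      omega
    obtain ⟨i, hi⟩ := Finset.card_eq_one.1 h1
    have hiS : i ∈ S \ T := by simp [hi]
    refine ⟨i, (Finset.mem_sdiff.1 hiS).1, ?_⟩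
    rw [Finset.erase_eq, ← hi, Finset.sdiff_sdiff_eq_self hT]
  set A := {j : ℕ | j ∈ S ∧ IsEmbedding (w.restrict (S.erase i)) w (S.erase j)} with hA
  -- Nonemptiness rules out the default value 0 of `sInf`.
  have hne : A.Nonempty := ⟨i, hi, (Finset.erase_subset _ _).trans hS, rfl⟩
  have hmem : sInf A ∈ A := Nat.sInf_mem hne
  refine ⟨?_, hmem.2.2⟩
  by_contra hno
  obtain ⟨j, hj, hjlt, hje⟩ := restrict_erase_eq_of_not_isRunHead hS hmem.1 hno
  have hjA : j ∈ A := ⟨hj, (Finset.erase_subset _ _).trans hS, hje.trans hmem.2.2⟩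
  exact absurd (Nat.sInf_le hjA) (not_le.2 hjlt)

end Word

section Labeling

open Word

variable {d : ℕ}

/-- The first deletion on the way to a rightmost embedding of `x` yields a word of `A*_d` between
`x` and `y` that is one letter shorter than `y`; under a cover it must be `x`. -/
theorem RestrictedWord.covBy_iff {x y : RestrictedWord d} :
    x ⋖ y ↔ x ≤ y ∧ x.1.length + 1 = y.1.length := by
  constructor
  · intro h
    refine ⟨h.le, ?_⟩
    have hS := subset_refl (Finset.Icc 1 y.1.length)
    have hy := restrict_full y.1
    obtain ⟨T, hT, hx, hr⟩ := exists_isRightmost hS (x := x.1) (hy.symm ▸ h.le)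
    obtain ⟨l, hl, hlT, -⟩ := hr.exists_isDeletion (d := d) hS hT (by rw [hy]; exact y.2)
      (by rw [hx]; exact x.2)
    cases l with
    | nil =>
      simp only [List.toFinset_nil, Finset.sdiff_empty] at hlT
      rw [← hlT, hy] at hx
      exact absurd (Subtype.ext hx.symm) h.ne
    | cons i l =>
      rw [sdiff_toFinset_cons] at hlT
      let z : RestrictedWord d := ⟨y.1.restrict ((Finset.Icc 1 y.1.length).erase i), hl.2.1⟩
      have hxz : x ≤ z := by
        change x.1 ≤ z.1
        rw [← hx, ← hlT]
        exact restrict_mono _ Finset.sdiff_subset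
      have hzl : z.1.length + 1 = y.1.length := by
        rw [length_restrict (Finset.erase_subset _ _), Finset.card_erase_add_one hl.1.1]
        simp
      have hzy : z < y := by
        refine lt_of_le_of_ne ?_ fun e => ?_
        · have := restrict_mono y.1 (Finset.erase_subset i (Finset.Icc 1 y.1.length))
          rwa [hy] at this
        · rw [e] at hzl
          omega
      rcases h.eq_or_eq hxz hzy.le with e | e
      · rw [← e]
        exact hzl
      · exact absurd e hzy.ne
  · rintro ⟨h, hl⟩
    have hc := covBy_of_length (u := x.1) (v := y.1) h hl
    exact ⟨lt_of_le_of_ne h fun e => hc.ne (congrArg _ e), fun z h1 h2 => hc.2 h1 h2⟩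

theorem deletionLabels_append (w : Word) (S : Finset ℕ) (xs ys : List Word) :
    deletionLabels w S (xs ++ ys) = deletionLabels w S xs ++
      deletionLabels w (S \ (deletionLabels w S xs).toFinset) ys := by
  induction xs generalizing S with
  | nil => simp [deletionLabels]
  | cons x xs ih =>
    simp only [List.cons_append, deletionLabels, ih, sdiff_toFinset_cons]

theorem length_deletionLabels (w : Word) (S : Finset ℕ) (xs : List Word) :
    (deletionLabels w S xs).length = xs.length := by
  induction xs generalizing S with
  | nil => rfl
  | cons x xs ih => simp [deletionLabels, ih]

theorem deletionLabels_take (w : Word) (S : Finset ℕ) (xs : List Word) (s : ℕ) :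
    deletionLabels w S (xs.take s) = (deletionLabels w S xs).take s := by
  induction xs generalizing S s with
  | nil => simp [deletionLabels]
  | cons x xs ih =>
    cases s with
    | zero => simp [deletionLabels]
    | succ s => simp [deletionLabels, ih]

/-! ### Saturated chains as deletion sequences -/

section Chains

variable {w : Word} {S : Finset ℕ} {y : RestrictedWord d}

theorem isDeletion_deletionLabels (hS : S ⊆ Finset.Icc 1 w.length) (hy : w.restrict S = y.1)
    {xs : List (RestrictedWord d)} (h : (y :: xs).IsChain (fun x y => y ⋖ x)) :
    IsDeletion d w S (deletionLabels w S (xs.map Subtype.val)) ∧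
      w.restrict (S \ (deletionLabels w S (xs.map Subtype.val)).toFinset) =
        ((y :: xs).getLast (by simp)).1 := by
  induction xs generalizing S y with
  | nil => simp [deletionLabels, IsDeletion, hy]
  | cons x xs ih =>
    rw [List.isChain_cons_cons] at h
    obtain ⟨hle, hlen⟩ := RestrictedWord.covBy_iff.1 h.1
    obtain ⟨h1, h2⟩ := isRunHead_sInf hS (x := x.1) (hy.symm ▸ hle) (hy.symm ▸ hlen)
    obtain ⟨h3, h4⟩ := ih ((Finset.erase_subset _ _).trans hS) h2 h.2
    simp only [List.map_cons, deletionLabels, sdiff_toFinset_cons]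
    refine ⟨⟨h1, ?_, h3⟩, h4⟩
    rw [h2]
    exact x.2

theorem exists_deletionLabels_eq (hS : S ⊆ Finset.Icc 1 w.length) (hy : w.restrict S = y.1)
    {l : List ℕ} (h : IsDeletion d w S l) :
    ∃ xs : List (RestrictedWord d), (y :: xs).IsChain (fun x y => y ⋖ x) ∧
      deletionLabels w S (xs.map Subtype.val) = l := by
  induction l generalizing S y with
  | nil => exact ⟨[], by simp, rfl⟩
  | cons i l ih =>
    have hSi : S.erase i ⊆ Finset.Icc 1 w.length := (Finset.erase_subset _ _).trans hS
    let z : RestrictedWord d := ⟨w.restrict (S.erase i), h.2.1⟩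
    obtain ⟨xs, h1, h2⟩ := ih (y := z) hSi rfl h.2.2
    refine ⟨z :: xs, List.isChain_cons_cons.2 ⟨RestrictedWord.covBy_iff.2 ⟨?_, ?_⟩, h1⟩, ?_⟩
    · change z.1 ≤ y.1
      rw [← hy]
      exact restrict_mono _ (Finset.erase_subset _ _)
    · rw [← hy, length_restrict hSi, length_restrict hS, Finset.card_erase_add_one h.1.1]
    · simp only [List.map_cons, deletionLabels, z, h.1.sInf_eq hS, h2]

/-- Each label `i` determines the next word, namely `w` restricted to `S.erase i`. -/
theorem eq_of_deletionLabels_eq (hS : S ⊆ Finset.Icc 1 w.length) (hy : w.restrict S = y.1)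
    {xs xs' : List (RestrictedWord d)} (h : (y :: xs).IsChain (fun x y => y ⋖ x))
    (h' : (y :: xs').IsChain (fun x y => y ⋖ x))
    (heq : deletionLabels w S (xs.map Subtype.val) = deletionLabels w S (xs'.map Subtype.val)) :
    xs = xs' := by
  induction xs generalizing S y xs' with
  | nil =>
    have := congrArg List.length heq
    rw [length_deletionLabels, length_deletionLabels] at this
    exact (List.length_eq_zero_iff.1 (by simpa using this.symm)).symm
  | cons x xs ih =>
    cases xs' with
    | nil => simp [deletionLabels] at heq
    | cons x' xs' =>
      rw [List.isChain_cons_cons] at h h'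
      obtain ⟨hle, hlen⟩ := RestrictedWord.covBy_iff.1 h.1
      obtain ⟨hle', hlen'⟩ := RestrictedWord.covBy_iff.1 h'.1
      have h2 := (isRunHead_sInf hS (x := x.1) (hy.symm ▸ hle) (hy.symm ▸ hlen)).2
      have h2' := (isRunHead_sInf hS (x := x'.1) (hy.symm ▸ hle') (hy.symm ▸ hlen')).2
      simp only [List.map_cons, deletionLabels, List.cons.injEq] at heq
      rw [heq.1] at h2
      obtain rfl : x = x' := Subtype.ext (h2.symm.trans h2')
      rw [ih ((Finset.erase_subset _ _).trans hS) h2' h.2 h'.2 heq.2]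

end Chains

theorem restrictedLabeling_cons (w : RestrictedWord d) (xs : List (RestrictedWord d)) :
    restrictedLabeling d (w :: xs) =
      (deletionLabels w.1 (Finset.Icc 1 w.1.length) (xs.map Subtype.val)).map (Nat.cast : ℕ → ℤ) := by
  simp [restrictedLabeling, bjornerLabeling, List.map_eq_flatMap]

/-- The root enters only through the set of positions it leaves, and the completion `t` not at all.
-/
theorem rootedLabels_restrictedLabeling (w y : RestrictedWord d) (rs xs t : List (RestrictedWord d)) :
    rootedLabels (restrictedLabeling d) (w :: rs) (y :: xs) t =
      (deletionLabels w.1 (Finset.Icc 1 w.1.length \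
        (deletionLabels w.1 (Finset.Icc 1 w.1.length) (rs.map Subtype.val)).toFinset)
        (xs.map Subtype.val)).map (Nat.cast : ℕ → ℤ) := by
  simp only [rootedLabels, List.tail_cons, List.cons_append, restrictedLabeling_cons,
    List.map_append, deletionLabels_append, List.append_assoc]
  rw [List.drop_left' (by simp [length_deletionLabels]),
    List.take_left' (by simp [length_deletionLabels])]

theorem List.Lex.map_natCast {l l' : List ℕ} (h : List.Lex (· < ·) l l') :
    List.Lex (· < ·) (l.map (Nat.cast : ℕ → ℤ)) (l'.map (Nat.cast : ℕ → ℤ)) := by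
  induction h with
  | nil => exact List.Lex.nil
  | cons _ ih => exact List.Lex.cons ih
  | rel h => exact List.Lex.rel (by exact_mod_cast h)

theorem RestrictedWord.length_of_isMaximalChain {u w : RestrictedWord d}
    {c : List (RestrictedWord d)} (h : IsMaximalChain u w c) :
    c.length + u.1.length = w.1.length + 1 := by
  obtain ⟨xs, rfl⟩ := h.exists_cons
  rw [isMaximalChain_cons_iff] at h
  obtain ⟨hc, rfl⟩ := h
  induction xs generalizing w with
  | nil => simp [Nat.add_comm]
  | cons x xs ih =>
    rw [List.isChain_cons_cons] at hc
    have h1 := (RestrictedWord.covBy_iff.1 hc.1).2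
    have h2 := ih hc.2
    simp only [List.length_cons, List.getLast_cons_cons] at h2 ⊢
    omega

theorem RestrictedWord.isMaximalChain_map_val {u w : RestrictedWord d}
    {c : List (RestrictedWord d)} (h : IsMaximalChain u w c) :
    IsMaximalChain u.1 w.1 (c.map Subtype.val) := by
  refine ⟨?_, by rw [List.head?_map, h.2.1, Option.map_some],
    by rw [List.getLast?_map, h.2.2, Option.map_some]⟩
  rw [List.isChain_map]
  refine h.1.imp fun x y hxy => ?_
  obtain ⟨h1, h2⟩ := RestrictedWord.covBy_iff.1 hxy
  exact covBy_of_length h1 h2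

theorem isDualCLLabeling_restrictedLabeling (u w : RestrictedWord d) :
    IsDualCLLabeling u w (restrictedLabeling d) where
  graded c c' hc hc' := by
    have h1 := RestrictedWord.length_of_isMaximalChain hc
    have h2 := RestrictedWord.length_of_isMaximalChain hc'
    omega
  length_eq c hc := by
    obtain ⟨xs, rfl⟩ := hc.exists_cons
    simp [restrictedLabeling_cons, length_deletionLabels]
  prefix_eq c c' hc hc' s _ h := by
    obtain ⟨xs, rfl⟩ := hc.exists_cons
    obtain ⟨xs', rfl⟩ := hc'.exists_cons
    simp only [List.take_succ_cons, List.cons.injEq, true_and] at h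
    simp only [restrictedLabeling_cons, ← List.map_take, ← deletionLabels_take, h]
  rooted x y hux hxy hyw r t hr ht := by
    obtain ⟨rs, rfl⟩ := hr.exists_cons
    rw [isMaximalChain_cons_iff] at hr
    obtain ⟨-, hS⟩ := isDeletion_deletionLabels subset_rfl (restrict_full w.1) hr.1
    rw [hr.2] at hS
    have key := fun xs => rootedLabels_restrictedLabeling w y rs xs t
    set S := Finset.Icc 1 w.1.length \
      (deletionLabels w.1 (Finset.Icc 1 w.1.length) (rs.map Subtype.val)).toFinset with hSdef
    have hSsub : S ⊆ Finset.Icc 1 w.1.length := Finset.sdiff_subset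
    obtain ⟨T, hT, hx, hright⟩ := exists_isRightmost hSsub (x := x.1) (hS.symm ▸ hxy)
    obtain ⟨l, hl, hlT, hlp, hlex⟩ := hright.exists_isDeletion (d := d) hSsub hT
      (by rw [hS]; exact y.2) (by rw [hx]; exact x.2)
    obtain ⟨xs, hxs, rfl⟩ := exists_deletionLabels_eq hSsub hS hl
    refine ⟨y :: xs, isMaximalChain_cons_iff.2 ⟨hxs, ?_⟩, ?_, ?_⟩
    · apply Subtype.ext
      rw [← (isDeletion_deletionLabels hSsub hS hxs).2, hlT, hx]
    · rw [key, List.pairwise_map]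
      exact hlp.imp fun h => by exact_mod_cast h
    · intro m' hm' hne
      obtain ⟨xs', rfl⟩ := hm'.exists_cons
      rw [isMaximalChain_cons_iff] at hm'
      obtain ⟨hd', he'⟩ := isDeletion_deletionLabels hSsub hS hm'.1
      obtain ⟨h1, h2⟩ := hlex _ hd' (by rw [he', hm'.2, hx]) fun e =>
        hne (by rw [eq_of_deletionLabels_eq hSsub hS hm'.1 hxs e])
      rw [key, key]
      refine ⟨fun hp => h1 ?_, h2.map_natCast⟩
      rw [List.pairwise_map] at hp
      exact hp.imp fun h => by exact_mod_cast h

/-! ### Descending chains and normal embeddings -/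

namespace Word

variable {u w : Word} {S T : Finset ℕ} {i j : ℕ}

/-- Whether `j` is a run head depends only on the positions up to `j`. -/
theorem isRunHead_erase_iff (hji : j < i) : IsRunHead w (S.erase i) j ↔ IsRunHead w S j := by
  simp only [IsRunHead, Finset.mem_erase]
  constructor
  · rintro ⟨⟨-, hj⟩, h⟩
    exact ⟨hj, fun k hk hkj hpred => h k ⟨by omega, hk⟩ hkj fun q hq => hpred q hq.2⟩
  · rintro ⟨hj, h⟩
    exact ⟨⟨hji.ne, hj⟩, fun k hk hkj hpred => h k hk.2 hkj fun q hq hqj =>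
      hpred q ⟨by omega, hq⟩ hqj⟩

/-- The positions that remain when the elements of `S \ T` have been deleted from right to left
down to `i`. -/
def positionsAfter (S T : Finset ℕ) (i : ℕ) : Finset ℕ :=
  S.filter (· < i) ∪ T.filter (i < ·)

theorem mem_positionsAfter {k : ℕ} :
    k ∈ positionsAfter S T i ↔ (k ∈ S ∧ k < i) ∨ (k ∈ T ∧ i < k) := by
  simp [positionsAfter]

theorem positionsAfter_erase (hji : j < i) :
    positionsAfter (S.erase i) T j = positionsAfter S T j := by
  ext k
  simp only [mem_positionsAfter, Finset.mem_erase]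
  grind

theorem positionsAfter_eq_erase (hT : T ⊆ S) (hmax : ∀ k ∈ S, i < k → k ∈ T) :
    positionsAfter S T i = S.erase i := by
  ext k
  have := @hT k
  have := hmax k
  simp only [mem_positionsAfter, Finset.mem_erase]
  grind

/-- Deleting from right to left leaves everything left of the current position untouched, so run
heads can be read off from the initial `S`. With the converse `exists_descending_isDeletion`, a
decreasing sequence becomes a condition on each deleted position separately. -/
theorem IsDeletion.of_descending {l : List ℕ} (h : IsDeletion d w S l) (hl : l.Pairwise (· > ·)) :
    ∀ i ∈ l, IsRunHead w S i ∧ RunsLE d (w.restrict (positionsAfter S (S \ l.toFinset) i)) := by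
  induction l generalizing S with
  | nil => simp
  | cons i l ih =>
    rw [List.pairwise_cons] at hl
    rw [sdiff_toFinset_cons]
    intro j hj
    rcases List.mem_cons.1 hj with rfl | hj
    · refine ⟨h.1, ?_⟩
      rw [positionsAfter_eq_erase (Finset.sdiff_subset.trans (Finset.erase_subset _ _))]
      · exact h.2.1
      · intro k hk hjk
        refine Finset.mem_sdiff.2 ⟨Finset.mem_erase.2 ⟨hjk.ne', hk⟩, fun hkl => ?_⟩
        have := hl.1 k (List.mem_toFinset.1 hkl)
        omega
    · have hji : j < i := hl.1 j hj
      have := ih h.2.2 hl.2 j hj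
      rwa [isRunHead_erase_iff hji, positionsAfter_erase hji] at this

theorem exists_descending_isDeletion (hT : T ⊆ S)
    (h : ∀ i ∈ S \ T, IsRunHead w S i ∧ RunsLE d (w.restrict (positionsAfter S T i))) :
    ∃ l : List ℕ, IsDeletion d w S l ∧ l.Pairwise (· > ·) ∧ S \ l.toFinset = T := by
  induction hn : (S \ T).card generalizing S with
  | zero =>
    rw [Finset.card_eq_zero, Finset.sdiff_eq_empty_iff_subset] at hn
    exact ⟨[], trivial, by simp, by simpa using hn.antisymm hT⟩
  | succ n ih =>
    have hne : (S \ T).Nonempty := Finset.card_pos.1 (by omega)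
    obtain ⟨i, hi⟩ : ∃ i, i = (S \ T).max' hne := ⟨_, rfl⟩
    have himem : i ∈ S \ T := hi ▸ Finset.max'_mem _ hne
    obtain ⟨hiS, hiT⟩ := Finset.mem_sdiff.1 himem
    have hmax : ∀ k ∈ S \ T, k ≤ i := fun k hk => hi ▸ Finset.le_max' _ _ hk
    have hTi : T ⊆ S.erase i := fun t ht => Finset.mem_erase.2 ⟨fun e => hiT (e ▸ ht), hT ht⟩
    have hstep : ∀ j ∈ S.erase i \ T, IsRunHead w (S.erase i) j ∧
        RunsLE d (w.restrict (positionsAfter (S.erase i) T j)) := by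
      intro j hj
      rw [Finset.erase_sdiff_comm] at hj
      obtain ⟨hji, hj⟩ := Finset.mem_erase.1 hj
      have hlt : j < i := lt_of_le_of_ne (hmax j hj) hji
      rw [isRunHead_erase_iff hlt, positionsAfter_erase hlt]
      exact h j hj
    obtain ⟨l, hl, hlp, hlT⟩ := ih hTi hstep (by
      rw [Finset.erase_sdiff_comm, Finset.card_erase_of_mem himem]
      omega)
    refine ⟨i :: l, ⟨(h i himem).1, ?_, hl⟩, List.pairwise_cons.2 ⟨fun j hj => ?_, hlp⟩, ?_⟩
    · rw [← positionsAfter_eq_erase hT]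
      · exact (h i himem).2
      · intro k hk hik
        by_contra hkT
        have := hmax k (Finset.mem_sdiff.2 ⟨hk, hkT⟩)
        omega
    · have hjS := Finset.mem_erase.1 (hl.subset_and_nodup.1 (List.mem_toFinset.2 hj))
      have hjT : j ∉ T := fun hjT => by
        rw [← hlT] at hjT
        exact (Finset.mem_sdiff.1 hjT).2 (List.mem_toFinset.2 hj)
      exact lt_of_le_of_ne (hmax j (Finset.mem_sdiff.2 ⟨hjS.2, hjT⟩)) hjS.1
    · rw [sdiff_toFinset_cons, hlT]

theorem isRunHead_full_iff (hi : i ∈ Finset.Icc 1 w.length) :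
    IsRunHead w (Finset.Icc 1 w.length) i ↔ i ∉ w.repetitionSet := by
  have hi' := Finset.mem_Icc.1 hi
  simp only [IsRunHead, hi, true_and, repetitionSet, Finset.mem_filter, Finset.mem_Icc]
  constructor
  · rintro h ⟨h2, heq⟩
    exact h (i - 1) (by omega) (by omega) (fun k hk hki => by omega) heq.symm
  · intro h j hj hji hpred heq
    have := hpred (i - 1) (by omega) (by omega)
    obtain rfl : j = i - 1 := by omega
    exact h ⟨by omega, heq.symm⟩

theorem letterAt_eq_a_or_b (hi : i ∈ Finset.Icc 1 w.length) :
    w.letterAt i = some Letter.a ∨ w.letterAt i = some Letter.b := by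
  obtain ⟨c, hc⟩ := exists_mem_zipIdx hi
  have := (letterAt_mem_zipIdx hc).1
  cases c
  · exact Or.inl this
  · exact Or.inr this

theorem le_length_of_letterAt {c : Letter} (h : u.letterAt j = some c) : j ≤ u.length := by
  cases j with
  | zero => exact Nat.zero_le _
  | succ j => exact (List.getElem?_eq_some_iff.1 h).1

/-- The positions in `T` from `p` to `h` hold at least `d` letters, all of them `b`. -/
def IsRunBetween (d : ℕ) (w : Word) (T : Finset ℕ) (p h : ℕ) : Prop :=
  (∀ i ∈ T, p ≤ i → i ≤ h → w.letterAt i = some Letter.b) ∧ d ≤ (T ∩ Finset.Icc p h).card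

theorem card_filter_lt_add_card_inter (T : Finset ℕ) {p h : ℕ} (hph : p ≤ h + 1) :
    (T.filter (· < p)).card + (T ∩ Finset.Icc p h).card = (T.filter (· ≤ h)).card := by
  rw [← Finset.card_union_of_disjoint]
  · congr 1
    ext k
    simp only [Finset.mem_union, Finset.mem_filter, Finset.mem_inter, Finset.mem_Icc]
    grind
  · rw [Finset.disjoint_left]
    simp only [Finset.mem_filter, Finset.mem_inter, Finset.mem_Icc]
    omega

theorem card_filter_lt_add_one {p : ℕ} (hp : p ∈ T) :
    (T.filter (· < p)).card + 1 = (T.filter (· ≤ p)).card := by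
  rw [← card_filter_lt_add_card_inter T (p := p) (h := p) (by omega)]
  simp [hp]

/-- Ranks in `T` turn consecutive letters of the subword into the elements of `T` in an interval of
positions of `w`. -/
theorem bRunAt_iff (hT : T ⊆ Finset.Icc 1 w.length) {p : ℕ} (hp : p ∈ T) :
    BRunAt d (w.restrict T) (T.filter (· ≤ p)).card ↔
      w.letterAt p = some Letter.b ∧ ∃ h, IsRunBetween d w T p h := by
  have hmono : ∀ {k l : ℕ}, k ≤ l → (T.filter (· ≤ k)).card ≤ (T.filter (· ≤ l)).card :=
    fun hkl => Finset.card_le_card (Finset.monotone_filter_right _ fun i _ hi => le_trans hi hkl)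
  have hrank := card_filter_lt_add_one hp
  rw [BRunAt, letterAt_restrict hT hp]
  refine and_congr_right fun hpb => ⟨fun hrun => ?_, ?_⟩
  · rcases Nat.eq_zero_or_pos d with rfl | hd
    · refine ⟨p, fun i _ h1 h2 => ?_, Nat.zero_le _⟩
      rwa [le_antisymm h2 h1]
    · have hle := le_length_of_letterAt (hrun (d - 1) (by omega))
      rw [length_restrict hT] at hle
      obtain ⟨h, hhT, hh⟩ := Finset.exists_card_filter_le_eq T (by omega) hle
      have hph : p ≤ h := by
        by_contra! hlt
        have h1 : (T.filter (· ≤ h)).card ≤ (T.filter (· < p)).card :=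
          Finset.card_le_card (Finset.monotone_filter_right _ fun i _ hi => lt_of_le_of_lt hi hlt)
        omega
      refine ⟨h, fun i hi h1 h2 => ?_, ?_⟩
      · have h3 := hmono h1
        have h4 := hmono h2
        rw [← letterAt_restrict hT hi]
        have := hrun ((T.filter (· ≤ i)).card - (T.filter (· ≤ p)).card) (by omega)
        rwa [Nat.add_sub_cancel' h3] at this
      · have := card_filter_lt_add_card_inter T (p := p) (h := h) (by omega)
        omega
  · rintro ⟨h, hb, hcard⟩ t ht
    have hph : p ≤ h + 1 := by
      by_contra! hlt
      rw [Finset.Icc_eq_empty_of_lt (by omega)] at hcard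
      simp at hcard
      omega
    have hsum := card_filter_lt_add_card_inter T hph
    have hle : (T.filter (· ≤ h)).card ≤ T.card := Finset.card_le_card (Finset.filter_subset _ _)
    obtain ⟨e, heT, he⟩ := Finset.exists_card_filter_le_eq T
      (j := (T.filter (· ≤ p)).card + t) (by omega) (by omega)
    rw [← he, letterAt_restrict hT heT]
    refine hb e heT ?_ ?_
    · by_contra! hlt
      have h1 : (T.filter (· ≤ e)).card ≤ (T.filter (· < p)).card :=
        Finset.card_le_card (Finset.monotone_filter_right _ fun i _ hi => lt_of_le_of_lt hi hlt)
      omega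
    · by_contra! hlt
      have h1 : (T.filter (· ≤ h)).card ≤ (T.filter (· < e)).card :=
        Finset.card_le_card (Finset.monotone_filter_right _ fun i _ hi => lt_of_le_of_lt hi hlt)
      have := card_filter_lt_add_one heT
      omega

/-- An interval `[l, h]` of too many `b`'s must have `l < i ≤ h`, since otherwise it is a run of `w`
or of the final subword. The positions strictly between `l` and `i` are repetitions, so they lie in
`T`. Hence `l ∉ T`, and `T` holds at least `d` letters `b` in `[l + 1, h]`. The first of these
violates every alternative of normality. -/
theorem RunsLE.positionsAfter_of_normal (hT : T ⊆ Finset.Icc 1 w.length) (hw : RunsLE d w)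
    (hu : RunsLE d (w.restrict T)) (hR : w.repetitionSet ⊆ T)
    (hn : ∀ p ∈ T, ∀ h, p ≤ h → IsRunBetween d w T p h →
      p = 1 ∨ (p = 2 ∧ w.letterAt 1 = some Letter.a) ∨ p - 1 ∈ T)
    (hi : i ∈ Finset.Icc 1 w.length) (hiT : i ∉ T) :
    RunsLE d (w.restrict (positionsAfter (Finset.Icc 1 w.length) T i)) := by
  have hsub : positionsAfter (Finset.Icc 1 w.length) T i ⊆ Finset.Icc 1 w.length :=
    Finset.union_subset (Finset.filter_subset _ _) ((Finset.filter_subset _ _).trans hT)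
  have hw' := (runsLE_restrict_iff (d := d) (subset_refl (Finset.Icc 1 w.length))).1
    (by rwa [restrict_full])
  rw [runsLE_restrict_iff hT] at hu
  rw [runsLE_restrict_iff hsub]
  intro l₀ h hb₀
  -- Cutting off at 1 ensures that every point of `[l, i)` is a genuine position of `w`.
  obtain ⟨l, hl⟩ : ∃ l, l = max l₀ 1 := ⟨_, rfl⟩
  have hU : positionsAfter (Finset.Icc 1 w.length) T i ∩ Finset.Icc l₀ h =
      positionsAfter (Finset.Icc 1 w.length) T i ∩ Finset.Icc l h := by
    ext k
    simp only [Finset.mem_inter, Finset.mem_Icc]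
    refine and_congr_right fun hk => ?_
    have := Finset.mem_Icc.1 (hsub hk)
    omega
  have hb : ∀ k ∈ positionsAfter (Finset.Icc 1 w.length) T i, l ≤ k → k ≤ h →
      w.letterAt k = some Letter.b := fun k hk h1 h2 => hb₀ k hk (by omega) h2
  rw [hU]
  simp only [mem_positionsAfter] at hb
  rw [Finset.mem_Icc] at hi
  have hsubT : ∀ k, k ∈ T → 1 ≤ k ∧ k ≤ w.length := fun k hk => Finset.mem_Icc.1 (hT hk)
  rcases Nat.lt_or_ge h i with hhi | hhi
  · refine le_trans (Finset.card_le_card fun k hk => ?_) (hw' l h fun k hk h1 h2 =>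
      hb k (Or.inl ⟨hk, by omega⟩) h1 h2)
    have := @hsub k
    simp only [Finset.mem_inter] at hk ⊢
    exact ⟨this hk.1, hk.2⟩
  rcases Nat.lt_or_ge l i |>.symm with hil | hil
  · refine le_trans (Finset.card_le_card fun k hk => ?_) (hu (max l (i + 1)) h fun k hk h1 h2 =>
      hb k (Or.inr ⟨hk, by omega⟩) (by omega) h2)
    simp only [Finset.mem_inter, Finset.mem_Icc, mem_positionsAfter] at hk ⊢
    rcases hk with ⟨hk | hk, h1, h2⟩
    · omega
    · exact ⟨hk.1, by omega, h2⟩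
  by_contra! hcard
  have hbl : ∀ k, l ≤ k → k < i → w.letterAt k = some Letter.b := fun k h1 h2 =>
    hb k (Or.inl ⟨Finset.mem_Icc.2 ⟨by omega, by omega⟩, h2⟩) h1 (by omega)
  have hTl : ∀ k, l < k → k < i → k ∈ T := by
    intro k h1 h2
    refine hR (Finset.mem_filter.2 ⟨Finset.mem_Icc.2 ⟨by omega, by omega⟩, ?_⟩)
    rw [hbl k (by omega) h2, hbl (k - 1) (by omega) (by omega)]
  have hTb : ∀ k ∈ T, l ≤ k → k ≤ h → w.letterAt k = some Letter.b := by
    intro k hk h1 h2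
    have hki : k ≠ i := fun e => hiT (e ▸ hk)
    rcases lt_or_gt_of_ne hki with hlt | hgt
    · exact hbl k h1 hlt
    · exact hb k (Or.inr ⟨hk, hgt⟩) h1 h2
  have hins : positionsAfter (Finset.Icc 1 w.length) T i ∩ Finset.Icc l h ⊆
      insert l (T ∩ Finset.Icc (l + 1) h) := by
    intro k hk
    simp only [Finset.mem_inter, Finset.mem_Icc, mem_positionsAfter, Finset.mem_insert] at hk ⊢
    by_cases hkl : k = l
    · exact Or.inl hkl
    · refine Or.inr ⟨?_, by omega, hk.2.2⟩
      rcases hk.1 with h1 | h1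
      · exact hTl k (by omega) h1.2
      · exact h1.1
  have hc1 := (Finset.card_le_card hins).trans (Finset.card_insert_le _ _)
  have hlT : l ∉ T := by
    intro hlT
    have h1 := hu l h hTb
    have hsub2 : insert l (T ∩ Finset.Icc (l + 1) h) ⊆ T ∩ Finset.Icc l h := by
      intro k hk
      simp only [Finset.mem_inter, Finset.mem_Icc, Finset.mem_insert] at hk ⊢
      rcases hk with rfl | hk
      · exact ⟨hlT, le_rfl, by omega⟩
      · exact ⟨hk.1, by omega, hk.2.2⟩
    have := (Finset.card_le_card hins).trans (Finset.card_le_card hsub2)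
    omega
  -- Needed when `d = 0`; if it were empty, the surviving letters would form a run of `w` before
  -- `i`.
  have hne : (T ∩ Finset.Icc (l + 1) h).Nonempty := by
    rw [Finset.nonempty_iff_ne_empty]
    intro hempty
    have h1 : positionsAfter (Finset.Icc 1 w.length) T i ∩ Finset.Icc l h ⊆
        Finset.Icc 1 w.length ∩ Finset.Icc l (i - 1) := by
      intro k hk
      have hk' := hins hk
      rw [hempty] at hk'
      simp only [Finset.mem_inter, Finset.mem_Icc, Finset.mem_insert, Finset.notMem_empty,
        or_false] at hk' ⊢
      omega
    have := (Finset.card_le_card h1).trans (hw' l (i - 1) fun k _ h1 h2 => hbl k h1 (by omega))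
    omega
  obtain ⟨p, hp⟩ : ∃ p, p = (T ∩ Finset.Icc (l + 1) h).min' hne := ⟨_, rfl⟩
  have hpmem := hp ▸ Finset.min'_mem _ hne
  have hpmin : ∀ k ∈ T ∩ Finset.Icc (l + 1) h, p ≤ k := fun k hk => hp ▸ Finset.min'_le _ _ hk
  simp only [Finset.mem_inter, Finset.mem_Icc] at hpmem hpmin
  have hrun : IsRunBetween d w T p h := by
    refine ⟨fun k hk h1 h2 => hTb k hk (by omega) h2, ?_⟩
    have : T ∩ Finset.Icc (l + 1) h ⊆ T ∩ Finset.Icc p h := by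
      intro k hk
      simp only [Finset.mem_inter, Finset.mem_Icc] at hk ⊢
      exact ⟨hk.1, hpmin k hk, hk.2.2⟩
    have := Finset.card_le_card this
    omega
  rcases hn p hpmem.1 h hpmem.2.2 hrun with h1 | ⟨h2, ha⟩ | h3
  · omega
  · obtain rfl : l = 1 := by omega
    rw [hbl 1 le_rfl hil] at ha
    cases ha
  · by_cases hpl : p - 1 = l
    · exact hlT (hpl ▸ h3)
    · have := hpmin (p - 1) ⟨h3, by omega, by omega⟩
      omega

/-- If all words reached by deleting `S \ T` from right to left lie in `A*_d`, then the letter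
of `w` in front of a run of `d` letters `b` of the subword at `T` is a supported `a`, or the run
is placed at the beginning of `w` or behind an initial `a`. -/
theorem normal_of_runsLE_positionsAfter (hT : T ⊆ Finset.Icc 1 w.length) (hw : RunsLE d w)
    (hu : RunsLE d (w.restrict T)) (hR : w.repetitionSet ⊆ T)
    (hA : ∀ i ∈ Finset.Icc 1 w.length, i ∉ T →
      RunsLE d (w.restrict (positionsAfter (Finset.Icc 1 w.length) T i)))
    {p h : ℕ} (hp : p ∈ T) (hpb : w.letterAt p = some Letter.b) (hrun : IsRunBetween d w T p h) :
    (w.letterAt (p - 1) = some Letter.a ∧ p - 1 ∈ T) ∨ p = 1 ∨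
      (p = 2 ∧ w.letterAt 1 = some Letter.a ∧ 1 ∉ T) := by
  have hA' : ∀ i ∈ Finset.Icc 1 w.length, i ∉ T → ∀ l h,
      (∀ k ∈ positionsAfter (Finset.Icc 1 w.length) T i, l ≤ k → k ≤ h →
        w.letterAt k = some Letter.b) →
      (positionsAfter (Finset.Icc 1 w.length) T i ∩ Finset.Icc l h).card ≤ d := fun i hi hiT =>
    (runsLE_restrict_iff (Finset.union_subset (Finset.filter_subset _ _)
      ((Finset.filter_subset _ _).trans hT))).1 (hA i hi hiT)
  have hw' := (runsLE_restrict_iff (d := d) (subset_refl (Finset.Icc 1 w.length))).1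
    (by rwa [restrict_full])
  rw [runsLE_restrict_iff hT] at hu
  obtain ⟨hb, hcard⟩ := hrun
  have hpn := Finset.mem_Icc.1 (hT hp)
  -- A set that contains the run and a further position in front of it is too large.
  have hbig : ∀ (q : ℕ) (U : Finset ℕ), q < p → q ∈ U → T ∩ Finset.Icc p h ⊆ U → ¬ U.card ≤ d := by
    intro q U hqp hqU hsub hle
    have h1 : insert q (T ∩ Finset.Icc p h) ⊆ U := Finset.insert_subset hqU hsub
    have h2 := Finset.card_le_card h1
    rw [Finset.card_insert_of_notMem (by simp; omega)] at h2
    omega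
  have hph : p ≤ h := by
    by_contra! hlt
    have hd : d = 0 := by
      rw [Finset.Icc_eq_empty_of_lt hlt] at hcard
      simpa using hcard
    have := hu p p fun k _ h1 h2 => le_antisymm h2 h1 ▸ hpb
    simp [hp, hd] at this
  by_cases hp1 : p = 1
  · exact Or.inr (Or.inl hp1)
  have hprev : p - 1 ∈ Finset.Icc 1 w.length := Finset.mem_Icc.2 ⟨by omega, by omega⟩
  by_cases hpT : p - 1 ∈ T
  · refine Or.inl ⟨(letterAt_eq_a_or_b hprev).resolve_right fun hbp => ?_, hpT⟩
    refine hbig (p - 1) (T ∩ Finset.Icc (p - 1) h) (by omega)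
      (Finset.mem_inter.2 ⟨hpT, Finset.mem_Icc.2 ⟨le_rfl, by omega⟩⟩)
      (Finset.inter_subset_inter_left (Finset.Icc_subset_Icc_left (by omega)))
      (hu _ _ fun k hk h1 h2 => ?_)
    by_cases hkp : k = p - 1
    · rw [hkp, hbp]
    · exact hb k hk (by omega) h2
  -- If `p - 1` held a `b`, it would still be present just after the first gap of `T` in `[p, h]` is
  -- deleted, giving `d + 1` letters `b` in a row. Without a gap, `w` itself has such a run.
  have hprevb : w.letterAt (p - 1) ≠ some Letter.b := by
    intro hbp
    by_cases hG : ∃ g, p ≤ g ∧ g ≤ h ∧ g ≤ w.length ∧ g ∉ T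
    · classical
      obtain ⟨h1, h2, h3, h4⟩ := Nat.find_spec hG
      have hmin := fun k => @Nat.find_min _ _ hG k
      set g := Nat.find hG
      refine hbig (p - 1) _ (by omega) ?_ ?_
        (hA' g (Finset.mem_Icc.2 ⟨by omega, h3⟩) h4 (p - 1) h fun k hk hk1 hk2 => ?_)
      · simp only [Finset.mem_inter, Finset.mem_Icc, mem_positionsAfter] at hprev ⊢
        omega
      · intro k hk
        simp only [Finset.mem_inter, Finset.mem_Icc, mem_positionsAfter] at hk ⊢
        have hkg : k ≠ g := fun e => h4 (e ▸ hk.1)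
        have := Finset.mem_Icc.1 (hT hk.1)
        rcases lt_or_gt_of_ne hkg with hlt | hgt
        · exact ⟨Or.inl ⟨this, hlt⟩, by omega, hk.2.2⟩
        · exact ⟨Or.inr ⟨hk.1, hgt⟩, by omega, hk.2.2⟩
      · rw [mem_positionsAfter] at hk
        by_cases hkp : k = p - 1
        · rw [hkp, hbp]
        · refine hb k ?_ (by omega) hk2
          rcases hk with hk | hk
          · by_contra hkT
            exact hmin k hk.2 ⟨by omega, hk2, (Finset.mem_Icc.1 hk.1).2, hkT⟩
          · exact hk.1
    · push Not at hG
      refine hbig (p - 1) _ (by omega) ?_ ?_ (hw' (p - 1) h fun k hk h1 h2 => ?_)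
      · exact Finset.mem_inter.2 ⟨hprev, Finset.mem_Icc.2 ⟨le_rfl, by omega⟩⟩
      · exact Finset.inter_subset_inter hT (Finset.Icc_subset_Icc_left (by omega))
      · by_cases hkp : k = p - 1
        · rw [hkp, hbp]
        · exact hb k (hG k (by omega) h2 (Finset.mem_Icc.1 hk).2) (by omega) h2
  have hpreva := (letterAt_eq_a_or_b hprev).resolve_right hprevb
  by_cases hp2 : p = 2
  · subst hp2
    exact Or.inr (Or.inr ⟨rfl, hpreva, hpT⟩)
  exfalso
  have hprev2 : p - 2 ∈ Finset.Icc 1 w.length := Finset.mem_Icc.2 ⟨by omega, by omega⟩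
  -- Here `p - 1` is an unsupported `a`. A preceding `a` would make it a repetition, hence
  -- supported; a preceding `b` joins the run as soon as `p - 1` is deleted.
  rcases letterAt_eq_a_or_b hprev2 with ha | hbp
  · refine hpT (hR (Finset.mem_filter.2 ⟨Finset.mem_Icc.2 ⟨by omega, by omega⟩, ?_⟩))
    rw [hpreva, show p - 1 - 1 = p - 2 by omega, ha]
  · refine hbig (p - 2) _ (by omega) ?_ ?_ (hA' (p - 1) hprev hpT (p - 2) h fun k hk h1 h2 => ?_)
    · simp only [Finset.mem_inter, Finset.mem_Icc, mem_positionsAfter] at hprev2 ⊢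
      omega
    · intro k hk
      simp only [Finset.mem_inter, Finset.mem_Icc, mem_positionsAfter] at hk ⊢
      exact ⟨Or.inr ⟨hk.1, by omega⟩, by omega, hk.2.2⟩
    · rw [mem_positionsAfter] at hk
      rcases hk with hk | hk
      · obtain rfl : k = p - 2 := by omega
        exact hbp
      · exact hb k hk.1 (by omega) h2

/-- Normality says exactly that the complement of `T` can be deleted from right to left within
`A*_d`; the rank of `p` in `T` decides whether the inner or the initial run condition applies. -/
theorem isNormalEmbedding_iff (hw : RunsLE d w) (hu : RunsLE d u) :
    IsNormalEmbedding d u w T ↔ IsEmbedding u w T ∧ ∀ i ∈ Finset.Icc 1 w.length \ T,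
      IsRunHead w (Finset.Icc 1 w.length) i ∧
        RunsLE d (w.restrict (positionsAfter (Finset.Icc 1 w.length) T i)) := by
  constructor
  · rintro ⟨he, hR, hin, hini⟩
    refine ⟨he, fun i hi => ?_⟩
    obtain ⟨hi, hiT⟩ := Finset.mem_sdiff.1 hi
    obtain ⟨hT, rfl⟩ := he
    refine ⟨(isRunHead_full_iff hi).2 fun h => hiT (hR h), ?_⟩
    refine RunsLE.positionsAfter_of_normal hT hw hu hR (fun p hp h hph hrun => ?_) hi hiT
    have hbrun := (bRunAt_iff hT hp).2 ⟨hrun.1 p hp le_rfl hph, h, hrun⟩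
    have hpos := card_filter_lt_add_one hp
    by_cases h1 : (T.filter (· ≤ p)).card = 1
    · rcases hini p hp h1 (h1 ▸ hbrun) with h2 | h2
      · exact Or.inl h2
      · exact Or.inr (Or.inl h2)
    · exact Or.inr (Or.inr (hin p hp (by omega) hbrun).2)
  · rintro ⟨he, hall⟩
    have hR : w.repetitionSet ⊆ T := by
      intro j hj
      by_contra hjT
      have hj' : j ∈ Finset.Icc 1 w.length := by
        have := Finset.mem_Icc.1 (Finset.mem_filter.1 hj).1
        exact Finset.mem_Icc.2 ⟨by omega, this.2⟩
      exact (isRunHead_full_iff hj').1 (hall j (Finset.mem_sdiff.2 ⟨hj', hjT⟩)).1 hj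
    have he' := he
    obtain ⟨hT, rfl⟩ := he
    have key := fun p hp hbr => let ⟨hb, h, hrun⟩ := (bRunAt_iff (d := d) hT (p := p) hp).1 hbr
      normal_of_runsLE_positionsAfter hT hw hu hR
        (fun i hi hiT => (hall i (Finset.mem_sdiff.2 ⟨hi, hiT⟩)).2) hp hb hrun
    refine ⟨he', hR, fun p hp hc hbr => ?_, fun p hp hc hbr => ?_⟩
    · rcases key p hp hbr with h | h | ⟨h, -, h1⟩
      · exact h
      · exfalso
        refine absurd hc (not_lt.2 ?_)
        have := Finset.card_le_card (s := T.filter (· ≤ p)) (t := {1}) fun k hk => by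
          have h1 := Finset.mem_filter.1 hk
          have := Finset.mem_Icc.1 (hT h1.1)
          simp only [Finset.mem_singleton]
          omega
        simpa using this
      · exfalso
        refine absurd hc (not_lt.2 ?_)
        have := Finset.card_le_card (s := T.filter (· ≤ p)) (t := {2}) fun k hk => by
          have h2 := Finset.mem_filter.1 hk
          have := Finset.mem_Icc.1 (hT h2.1)
          have hk1 : k ≠ 1 := fun e => h1 (e ▸ h2.1)
          simp only [Finset.mem_singleton]
          omega
        simpa using this
    · rcases key p hp (hc ▸ hbr) with h | h | ⟨h, h1, -⟩
      · exfalso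
        have hlt : 1 < (T.filter (· ≤ p)).card := by
          refine Finset.one_lt_card.2 ⟨p - 1, Finset.mem_filter.2 ⟨h.2, by omega⟩, p,
            Finset.mem_filter.2 ⟨hp, le_rfl⟩, ?_⟩
          have := Finset.mem_Icc.1 (hT hp)
          omega
        omega
      · exact Or.inl h
      · exact Or.inr ⟨h, h1⟩

end Word

/-! ### Counting descending chains -/

theorem List.eq_of_pairwise_gt_of_toFinset_eq {l l' : List ℕ} (h : l.Pairwise (· > ·))
    (h' : l'.Pairwise (· > ·)) (heq : l.toFinset = l'.toFinset) : l = l' := by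
  refine List.Perm.eq_of_pairwise' h h' ?_
  exact List.perm_of_nodup_nodup_toFinset_eq (h.imp fun hab => hab.ne') (h'.imp fun hab => hab.ne')
    heq

theorem mem_descendingChains_iff {u w : RestrictedWord d} {xs : List (RestrictedWord d)} :
    w :: xs ∈ descendingChains d u w ↔ IsMaximalChain u w (w :: xs) ∧
      (deletionLabels w.1 (Finset.Icc 1 w.1.length) (xs.map Subtype.val)).Pairwise (· > ·) := by
  simp [descendingChains, restrictedLabeling_cons, List.pairwise_map]

/-- A chain is sent to the positions that survive it. A decreasing deletion sequence is determined
by its set of positions, so nothing is lost. -/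
theorem ncard_descendingChains (u w : RestrictedWord d) :
    (descendingChains d u w).ncard = {ι | IsNormalEmbedding d u.1 w.1 ι}.ncard := by
  refine Set.ncard_congr (fun c _ => Finset.Icc 1 w.1.length \
    (deletionLabels w.1 (Finset.Icc 1 w.1.length) (c.tail.map Subtype.val)).toFinset) ?_ ?_ ?_
  · intro c hc
    obtain ⟨xs, rfl⟩ := hc.1.exists_cons
    rw [mem_descendingChains_iff, isMaximalChain_cons_iff] at hc
    obtain ⟨h1, h2⟩ := isDeletion_deletionLabels subset_rfl (restrict_full w.1) hc.1.1
    rw [Set.mem_ofPred_eq, isNormalEmbedding_iff w.2 u.2]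
    refine ⟨⟨Finset.sdiff_subset, by rw [List.tail_cons, h2, hc.1.2]⟩, fun i hi => ?_⟩
    refine h1.of_descending hc.2 i ?_
    simp only [Finset.mem_sdiff, not_and, not_not, List.mem_toFinset] at hi
    exact hi.2 hi.1
  · intro c c' hc hc' heq
    obtain ⟨xs, rfl⟩ := hc.1.exists_cons
    obtain ⟨xs', rfl⟩ := hc'.1.exists_cons
    rw [mem_descendingChains_iff, isMaximalChain_cons_iff] at hc hc'
    have h1 := (isDeletion_deletionLabels subset_rfl (restrict_full w.1) hc.1.1).1
    have h2 := (isDeletion_deletionLabels subset_rfl (restrict_full w.1) hc'.1.1).1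
    simp only [List.tail_cons] at heq
    have h3 := List.eq_of_pairwise_gt_of_toFinset_eq hc.2 hc'.2 (by
      rw [← Finset.sdiff_sdiff_eq_self h1.subset_and_nodup.1, heq,
        Finset.sdiff_sdiff_eq_self h2.subset_and_nodup.1])
    rw [eq_of_deletionLabels_eq subset_rfl (restrict_full w.1) hc.1.1 hc'.1.1 h3]
  · intro T hT
    obtain ⟨⟨hTs, hTu⟩, hall⟩ := (isNormalEmbedding_iff w.2 u.2).1 hT
    obtain ⟨l, hl, hlp, hlT⟩ := exists_descending_isDeletion hTs hall
    obtain ⟨xs, hxs, rfl⟩ := exists_deletionLabels_eq subset_rfl (restrict_full w.1) hl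
    refine ⟨w :: xs, mem_descendingChains_iff.2 ⟨isMaximalChain_cons_iff.2 ⟨hxs, ?_⟩, hlp⟩, hlT⟩
    apply Subtype.ext
    rw [← (isDeletion_deletionLabels subset_rfl (restrict_full w.1) hxs).2, hlT, hTu]

theorem take_restrictedLabeling (c t : List (RestrictedWord d)) (hc : c ≠ []) :
    (restrictedLabeling d (c ++ t)).take (c.length - 1) = restrictedLabeling d c := by
  cases c with
  | nil => exact absurd rfl hc
  | cons w xs =>
    rw [List.cons_append, restrictedLabeling_cons, restrictedLabeling_cons, List.map_append,
      deletionLabels_append, List.map_append]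
    exact List.take_left' (by simp [length_deletionLabels])

end Labeling

theorem theorem3p2 (d : ℕ) :
    (∀ u w : RestrictedWord d, u ≤ w →
      (∀ c, IsMaximalChain u w c → IsMaximalChain u.1 w.1 (c.map Subtype.val)) ∧
      IsDualCLLabeling u w (restrictedLabeling d)) ∧
    IsDualCLShellable (RestrictedWord d) ∧
    (∀ u w : RestrictedWord d, u ≤ w → IsShellable (orderComplex u w)) ∧
    (∀ u w : RestrictedWord d,
      (descendingChains d u w).ncard = {ι | Word.IsNormalEmbedding d u.1 w.1 ι}.ncard ∧
      IncidenceAlgebra.mu ℤ u w =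
        (-1) ^ (w.1.length + u.1.length) * ({ι | Word.IsNormalEmbedding d u.1 w.1 ι}.ncard : ℤ)) := by
  have hCL := fun u w : RestrictedWord d => isDualCLLabeling_restrictedLabeling u w
  refine ⟨fun u w _ => ⟨fun c => RestrictedWord.isMaximalChain_map_val, hCL u w⟩,
    fun u w _ => ⟨_, hCL u w⟩, fun u w huw => (hCL u w).isShellable huw,
    fun u w => ⟨ncard_descendingChains u w, ?_⟩⟩
  rw [← ncard_descendingChains]
  -- Word length serves as the rank function, as covers lose one letter.
  exact mu_eq_ncard_descending (ρ := fun x => x.1.length) (fun u w _ => hCL u w)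
    take_restrictedLabeling (fun x y hxy => (RestrictedWord.covBy_iff.1 hxy).2) u w
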